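/- **Conventions.** A *three-dimensional RKHS* $H$ is a three-dimensional complex inner product space (inner product linear in the first argument) with a distinguished basis $k_1,k_2,k_3$ of *reproducing kernels* indexed by the points of $X=X(H)=\{x_1,x_2,x_3\}$, such that $k_{ij}:=\langle k_i,k_j\rangle\neq 0$ for all $i,j$; $h\in H$ is regarded as a function on $X$ by $h(x_i)=\langle h,k_i\rangle$. Put $\hat k_i=k_i/\|k_i\|$, $\widehat{k_{ij}}=\langle\hat k_i,\hat k_j\rangle$, and $$\delta_{ij}=\delta_H(x_i,x_j)=\sqrt{1-|\widehat{k_{ij}}|^2},\qquad A_{123}=\arg(k_{12}k_{23}k_{31})\in(-\pi,\pi],\qquad LF_{123}^2=\frac1{\delta_{12}^2}\left|1-\frac{k_{21}k_{13}}{k_{23}k_{11}}\right|^2 .$$ A *multiplier* with symbol $m:X\to\mathbb C$ is the operator $M_m$ on $H$ with $(M_mh)(x)=m(x)h(x)$, with the operator norm, and $$\delta_G(x,y)=\sup\{\operatorname{Re}m(x): m(y)=0,\ \|M_m\|\le 1\}.$$ For $Y\subset X$ let $H_Y$ be the span of the $k_y$, $y\in Y$, as an RKHS on $Y$. $H$ has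 the *Pick property* if for every $Y\subset X$ every multiplier of norm one on $H_Y$ is the restriction (of symbols) of a multiplier of norm one on $H$; it has the *complete Pick property* (CPP) if for all $p,q$ the same holds for multipliers $H_Y\otimes\mathbb C^q\to H_Y\otimes\mathbb C^p$ with $p\times q$ matrix-valued symbols. $DA_n$ is the RKHS on the unit ball $\mathbb B^n\subset\mathbb C^n$ with kernels $k_z(\zeta)=(1-\langle\zeta,z\rangle)^{-1}$. For an injective map $\Phi:X\to\mathbb B^n$, $DA_n(\Phi(X))$ is the span of the kernels of the points of $\Phi(X)$, as an RKHS on $\Phi(X)$. $H'$ is a *rescaling* of $H$, $H\sim H'$, if (with points of $X(H)$ and $X(H')$ matched in order) there are nonzero $\gamma_i\in\mathbb C$ with $k'_{ij}=\gamma_i\overline{\gamma_j}k_{ij}$; in $H\sim DA_n(\Phi(X))$ the point $x_i$ is matched with $\Phi(x_i)$. Two ordered triples in $\mathbb B^n$ are *congruent* if a holomorphic automorphism of $\mathbb B^n$ takes one to the other, respecting the order. **Theorem.** Let $H$ be a three-dimensional RKHS, $X(H)=\{x_1,x_2,x_3\}$. The following are equivalent: 1. $H$ has the complete Pick property. 2.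 $H$ has the Pick property. 3. There are $i\ne j$ with $\delta_H(x_i,x_j)=\delta_G(x_i,x_j)$. 4. $LF_{123}^2\le\delta_{13}^2$. 5. $$\frac1{|\widehat{k_{12}}|^2}+\frac1{|\widehat{k_{23}}|^2}+\frac1{|\widehat{k_{13}}|^2}-1\le\frac{2\cos A_{123}}{|\widehat{k_{12}}||\widehat{k_{23}}||\widehat{k_{13}}|}.$$ 6. There are $w\in\mathbb C$, $s>0$ and $t\ge0$ such that, with $\Phi(x_1)=(0,0)$, $\Phi(x_2)=(s,0)$, $\Phi(x_3)=(w,t)$, the points $\Phi(x_i)$ are in $\mathbb B^2$ and $H\sim DA_2(\Phi(X))$. Furthermore, the parameters $\delta_{12},\delta_{13},\delta_{23},A_{123}$ are invariant under rescaling, and they uniquely determine the rescaling class of $H$, the points $\Phi(x_i)$ of (6), and the congruence class of the triangle realizing $H$. That is, let $H$ and $H'$ be three-dimensional RKHS, with points labelled by $1,2,3$. Then $H\sim H'$ if and only if the four parameters of $H$ and of $H'$ agree. If they agree, then (a) whenever $\Phi$ and $\Phi'$ are as in (6) for $H$ and $H'$ respectively, $\Phi(x_i)=\Phi'(x'_i)$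 for $i=1,2,3$; and (b) for every $n$, whenever $\Phi,\Phi'$ are injective maps into $\mathbb B^n$ with $H\sim DA_n(\Phi(X))$ and $H'\sim DA_n(\Phi'(X'))$, the ordered triples $(\Phi(x_i))_i$ and $(\Phi'(x_i'))_i$ are congruent. -/

import Mathlib

open scoped ComplexConjugate

noncomputable section

namespace FinRKHS

section Kernel

variable {X : Type*} (H : Type*) [NormedAddCommGroup H] [InnerProductSpace ℂ H]
  [CompleteSpace H] [RKHS ℂ H X ℂ]

/-- The reproducing kernel `k_x`, a vector of `H` (also a function on `X`). -/
def kvec (x : X) : H := RKHS.kerFun H x (1 : ℂ)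

/-- Reproducing property: the value `h(x)` is the inner product of `h` and `k_x`
(in Mathlib the inner product is conjugate linear in its first argument). -/
theorem inner_kvec (h : H) (x : X) : inner ℂ (kvec H x) h = h x := by
  rw [kvec, RKHS.kerFun_inner]
  simp

/-- The Gram matrix entry `k_{xy} = ⟨k_x, k_y⟩ = k_x(y)`. The form `⟨·, ·⟩` of the text is
linear in its first argument, so the arguments appear in the opposite order here. -/
def k (x y : X) : ℂ := inner ℂ (kvec H y) (kvec H x)

theorem k_eq_eval (x y : X) : k H x y = (kvec H x) y := inner_kvec H _ y

/-- The normalized kernel `k̂_x = k_x / ‖k_x‖`. -/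
def kvecHat (x : X) : H := ((‖kvec H x‖ : ℂ)⁻¹) • kvec H x

/-- `k̂_{xy} = ⟨k̂_x, k̂_y⟩`. -/
def kHat (x y : X) : ℂ := inner ℂ (kvecHat H y) (kvecHat H x)

/-- The standing conventions on a finite dimensional RKHS: the reproducing kernels are a basis of
`H`, and no two of them are orthogonal. -/
structure IsIrreducible : Prop where
  linearIndependent : LinearIndependent ℂ (kvec H)
  span_eq_top : Submodule.span ℂ (Set.range (kvec H)) = ⊤
  k_ne_zero : ∀ x y : X, k H x y ≠ 0

/-- The metric `δ_H(x, y)`, with `δ_H(x, y)² = 1 - |k̂_{xy}|²`. -/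
def deltaH (x y : X) : ℝ := √(1 - ‖kHat H x y‖ ^ 2)

/-- The angular invariant `A(x, y, z) = arg (k_{xy} k_{yz} k_{zx})`. -/
def angular (x y z : X) : ℝ := Complex.arg (k H x y * k H y z * k H z x)

/-- The invariant `LF²(x, y, z)` (with `x, y, z` in the roles of the points 1, 2, 3). -/
def LFsq (x y z : X) : ℝ :=
  1 / deltaH H x y ^ 2 * ‖1 - (k H y x * k H x z) / (k H y z * k H x x)‖ ^ 2

/-- `T` is the multiplier operator on `H` with symbol `m`. -/
def IsMultiplier (m : X → ℂ) (T : H →L[ℂ] H) : Prop :=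
  ∀ (h : H) (x : X), (T h) x = m x * h x

/-- The Gleason metric `δ_G(x, y)` of the multiplier algebra. -/
def deltaG (x y : X) : ℝ :=
  sSup {r : ℝ | ∃ (m : X → ℂ) (T : H →L[ℂ] H),
    IsMultiplier H m T ∧ m y = 0 ∧ ‖T‖ ≤ 1 ∧ r = (m x).re}

/-- `T` is the multiplier operator with matrix-valued symbol `m`, from `H ⊗ ℂ^q` (realized as the
Hilbert space of `q`-tuples from `H`) to `H ⊗ ℂ^p`. -/
def IsMatrixMultiplier {p q : ℕ} (m : X → Matrix (Fin p) (Fin q) ℂ)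
    (T : PiLp 2 (fun _ : Fin q => H) →L[ℂ] PiLp 2 (fun _ : Fin p => H)) : Prop :=
  ∀ (h : PiLp 2 (fun _ : Fin q => H)) (i : Fin p) (x : X),
    (T h i : H) x = ∑ j, m x i j * (h j : H) x

/-- The subspace `H_Y` of `H` spanned by the kernels `k_y`, `y ∈ Y`. -/
def kerSpan (Y : Set X) : Submodule ℂ H := Submodule.span ℂ (kvec H '' Y)

instance finiteDimensional_kerSpan (Y : Set X) [Finite Y] : FiniteDimensional ℂ (kerSpan H Y) :=
  FiniteDimensional.span_of_finite ℂ (Set.Finite.image _ (Set.toFinite Y))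

instance completeSpace_kerSpan (Y : Set X) [Finite Y] : CompleteSpace (kerSpan H Y) :=
  FiniteDimensional.complete ℂ _

/-- `H_Y` is a RKHS of functions on `Y`: its vectors are restricted to `Y`. -/
instance rkhsKerSpan (Y : Set X) : RKHS ℂ (kerSpan H Y) Y ℂ where
  coeCLM := ContinuousLinearMap.pi fun y : Y =>
    ((innerSL ℂ (kvec H (y : X))).comp (kerSpan H Y).subtypeL)
  coeCLM_injective := by
    refine (injective_iff_map_eq_zero _).mpr fun f hf => ?_
    have h1 : ∀ y ∈ Y, inner ℂ (kvec H y) (f : H) = 0 := fun y hy => by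
      have := congrFun hf ⟨y, hy⟩
      simpa using this
    have h2 : ∀ g ∈ kerSpan H Y, inner ℂ g (f : H) = 0 := by
      intro g hg
      induction hg using Submodule.span_induction with
      | mem g hg => obtain ⟨y, hy, rfl⟩ := hg; exact h1 y hy
      | zero => simp
      | add a b _ _ ha hb => rw [inner_add_left, ha, hb, add_zero]
      | smul c a _ ha => rw [inner_smul_left, ha, mul_zero]
    exact Subtype.ext (inner_self_eq_zero.mp (h2 _ f.2))

theorem kerSpan_apply (Y : Set X) (f : kerSpan H Y) (y : Y) : f y = (f : H) (y : X) := by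
  exact inner_kvec H (f : H) (y : X)

/-- The (scalar) Pick property: every multiplier of norm one on a space `H_Y` extends to a
multiplier of norm one on `H`. -/
def HasPick [Finite X] : Prop :=
  ∀ (Y : Set X) (n : Y → ℂ) (N : kerSpan H Y →L[ℂ] kerSpan H Y),
    IsMultiplier (kerSpan H Y) n N → ‖N‖ = 1 →
    ∃ (m : X → ℂ) (M : H →L[ℂ] H),
      IsMultiplier H m M ∧ ‖M‖ = 1 ∧ ∀ y : Y, m y = n y

/-- The complete Pick property: the same extension property for matrix-valued multipliers of every
size. -/
def HasCompletePick [Finite X] : Prop :=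
  ∀ (p q : ℕ) (Y : Set X) (n : Y → Matrix (Fin p) (Fin q) ℂ)
    (N : PiLp 2 (fun _ : Fin q => kerSpan H Y) →L[ℂ] PiLp 2 (fun _ : Fin p => kerSpan H Y)),
    IsMatrixMultiplier (kerSpan H Y) n N → ‖N‖ = 1 →
    ∃ (m : X → Matrix (Fin p) (Fin q) ℂ)
      (M : PiLp 2 (fun _ : Fin q => H) →L[ℂ] PiLp 2 (fun _ : Fin p => H)),
      IsMatrixMultiplier H m M ∧ ‖M‖ = 1 ∧ ∀ y : Y, m y = n y

/-- `H'` is a rescaling of `H` by means of the identification `e` of the underlying sets. -/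
def IsRescaling {X' : Type*} (H' : Type*) [NormedAddCommGroup H'] [InnerProductSpace ℂ H']
    [CompleteSpace H'] [RKHS ℂ H' X' ℂ] (e : X ≃ X') : Prop :=
  ∃ γ : X → ℂ, (∀ x, γ x ≠ 0) ∧
    ∀ x y, k H' (e x) (e y) = γ x * conj (γ y) * k H x y

end Kernel

section DruryArveson

/-- The open unit ball of `ℂⁿ`. -/
abbrev Ball (n : ℕ) : Type := Metric.ball (0 : EuclideanSpace ℂ (Fin n)) 1

/-- The Drury-Arveson kernel. The entry at `(z, w)` is (multiplication by)
`k_w(z) = 1 / (1 - ∑ zᵢ conj wᵢ)`. -/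
def daKernel (n : ℕ) : Matrix (Ball n) (Ball n) (ℂ →L[ℂ] ℂ) :=
  Matrix.of fun z w =>
    (1 - inner ℂ (w : EuclideanSpace ℂ (Fin n)) (z : EuclideanSpace ℂ (Fin n)))⁻¹ •
      ContinuousLinearMap.id ℂ ℂ

theorem norm_inner_ball_lt {n : ℕ} (z w : Ball n) :
    ‖inner ℂ (w : EuclideanSpace ℂ (Fin n)) (z : EuclideanSpace ℂ (Fin n))‖ < 1 := by
  have hz : ‖(z : EuclideanSpace ℂ (Fin n))‖ < 1 := mem_ball_zero_iff.mp z.2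
  have hw : ‖(w : EuclideanSpace ℂ (Fin n))‖ < 1 := mem_ball_zero_iff.mp w.2
  refine (norm_inner_le_norm _ _).trans_lt ?_
  nlinarith [norm_nonneg (z : EuclideanSpace ℂ (Fin n)),
    norm_nonneg (w : EuclideanSpace ℂ (Fin n))]

theorem inner_pow_sum_nonneg {n : ℕ} (d : ℕ) (s : Finset (Ball n)) (c : Ball n → ℂ) :
    0 ≤ (∑ w ∈ s, ∑ z ∈ s, c w * conj (c z) *
      inner ℂ (z : EuclideanSpace ℂ (Fin n)) (w : EuclideanSpace ℂ (Fin n)) ^ d).re := by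
  have h : (∑ w ∈ s, ∑ z ∈ s, c w * conj (c z) *
      inner ℂ (z : EuclideanSpace ℂ (Fin n)) (w : EuclideanSpace ℂ (Fin n)) ^ d)
      = ∑ f : Fin d → Fin n, (∑ w ∈ s, c w * ∏ i, w.1 (f i)) *
          conj (∑ z ∈ s, c z * ∏ i, z.1 (f i)) := by
    simp only [map_sum, map_mul, map_prod, Finset.sum_mul_sum]
    rw [Finset.sum_comm' (s := Finset.univ) (t := fun _ => s) (s' := fun _ => Finset.univ)
      (t' := s) (by simp)]
    refine Finset.sum_congr rfl fun w _ => ?_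
    rw [Finset.sum_comm' (s := Finset.univ) (t := fun _ => s) (s' := fun _ => Finset.univ)
      (t' := s) (by simp)]
    refine Finset.sum_congr rfl fun z _ => ?_
    rw [PiLp.inner_apply, Fintype.sum_pow, Finset.mul_sum]
    refine Finset.sum_congr rfl fun f _ => ?_
    simp only [RCLike.inner_apply, Finset.prod_mul_distrib]
    ring
  rw [h, Complex.re_sum]
  refine Finset.sum_nonneg fun f _ => ?_
  rw [Complex.mul_conj]
  simpa using Complex.normSq_nonneg _

theorem daKernel_posSemidef (n : ℕ) : (daKernel n).PosSemidef := by
  have key := (RKHS.posSemidef_tfae (K := daKernel n)).out 0 2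
  refine key.mpr ⟨?_, fun c => ?_⟩
  · ext z w
    simp [daKernel, Matrix.conjTranspose_apply, ContinuousLinearMap.star_eq_adjoint,
      ContinuousLinearMap.adjoint_id]
  · have hs : HasSum (fun d : ℕ => ∑ w ∈ c.support, ∑ z ∈ c.support, conj (c w) * conj (conj (c z)) *
        inner ℂ (z : EuclideanSpace ℂ (Fin n)) (w : EuclideanSpace ℂ (Fin n)) ^ d)
        (∑ w ∈ c.support, ∑ z ∈ c.support, conj (c w) * conj (conj (c z)) *
          (1 - inner ℂ (z : EuclideanSpace ℂ (Fin n)) (w : EuclideanSpace ℂ (Fin n)))⁻¹) :=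
      hasSum_sum fun w _ => hasSum_sum fun z _ =>
        (hasSum_geometric_of_norm_lt_one (norm_inner_ball_lt w z)).mul_left _
    have h0 := HasSum.nonneg (fun d => inner_pow_sum_nonneg d c.support fun z => conj (c z))
      (Complex.hasSum_re hs)
    refine h0.trans_eq ?_
    simp only [Finsupp.sum, daKernel, RCLike.re_to_complex]
    refine congrArg Complex.re (Finset.sum_congr rfl fun w _ => Finset.sum_congr rfl fun z _ => ?_)
    simp
    ring

instance fact_daKernel_posSemidef (n : ℕ) : Fact (daKernel n).PosSemidef := ⟨daKernel_posSemidef n⟩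

/-- The Drury-Arveson space `DA_n`, the RKHS on the ball defined by the Drury-Arveson kernel. -/
abbrev DA (n : ℕ) : Type := RKHS.OfKernel (daKernel n)

theorem kDA (n : ℕ) (z w : Ball n) :
    k (DA n) z w =
      (1 - inner ℂ (z : EuclideanSpace ℂ (Fin n)) (w : EuclideanSpace ℂ (Fin n)))⁻¹ := by
  rw [k_eq_eval, kvec, RKHS.kerFun_apply, RKHS.OfKernel.kernel_ofKernel]
  simp [daKernel]

/-- `H ∼ DA_n(Φ(X))`, the rescaling being the one that matches `a ∈ X` with the point `Φ a` of
the ball (in particular `Φ` is one to one). Here `DA_n(Y)` is the span in `DA_n` of the kernels of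
the points of `Y`, as a RKHS on `Y`. -/
def IsRealization {X : Type*} [Finite X] (H : Type*) [NormedAddCommGroup H]
    [InnerProductSpace ℂ H] [CompleteSpace H] [RKHS ℂ H X ℂ] {n : ℕ} (Φ : X → Ball n) : Prop :=
  ∃ e : X ≃ Set.range Φ, (∀ a, (e a : Ball n) = Φ a) ∧
    IsRescaling H (kerSpan (DA n) (Set.range Φ)) e

/-- The points `Φ(x₁), Φ(x₂), Φ(x₃)` of the ball of `ℂ²` are `(0,0), (s,0), (w,t)` with `s > 0` and
`t ≥ 0`. -/
def IsNormalTriple {X : Type*} (x : Fin 3 ≃ X) (Φ : X → Ball 2) (s : ℝ) (w : ℂ) (t : ℝ) : Prop :=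
  0 < s ∧ 0 ≤ t ∧
    (Φ (x 0) : EuclideanSpace ℂ (Fin 2)) = !₂[0, 0] ∧
    (Φ (x 1) : EuclideanSpace ℂ (Fin 2)) = !₂[(s : ℂ), 0] ∧
    (Φ (x 2) : EuclideanSpace ℂ (Fin 2)) = !₂[w, (t : ℂ)]

/-- Holomorphic self-maps of the ball. -/
def IsHolomorphic {n : ℕ} (f : Ball n → Ball n) : Prop :=
  ∃ F : EuclideanSpace ℂ (Fin n) → EuclideanSpace ℂ (Fin n),
    DifferentiableOn ℂ F (Metric.ball 0 1) ∧ ∀ z : Ball n, F z = f z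

/-- Congruence of two (ordered) systems of points of the ball: some holomorphic automorphism of the
ball takes the one to the other. -/
def BallCongruent {ι : Type*} {n : ℕ} (p q : ι → Ball n) : Prop :=
  ∃ φ : Ball n ≃ Ball n, IsHolomorphic φ ∧ IsHolomorphic φ.symm ∧ ∀ i, φ (p i) = q i

end DruryArveson

section Three

variable {X : Type*} (H : Type*) [NormedAddCommGroup H] [InnerProductSpace ℂ H]
  [CompleteSpace H] [RKHS ℂ H X ℂ]

/-- The parameters `(δ₁₂, δ₁₃, δ₂₃, A₁₂₃)`. -/
def invariants (x : Fin 3 ≃ X) : ℝ × ℝ × ℝ × ℝ :=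
  (deltaH H (x 0) (x 1), deltaH H (x 0) (x 2), deltaH H (x 1) (x 2),
    angular H (x 0) (x 1) (x 2))

end Three

end FinRKHS

end

/-!
Rescaling `H` so that `k_a = 1` leaves the numbers `r_{bc} = k_{ba} k_{ac} / (k_{bc} k_{aa})`, which
determine the rescaling class, and `H ∼ DA_n(Φ(X))` with `Φ a = 0` says that
`1 - r_{bc} = ⟨Φ b, Φ c⟩`. For three points the Gram matrix to be realized is `2 × 2`, with diagonal
entries `δ_{ab}²` and `δ_{ac}²`, so its positivity is the single inequality
`|1 - r_{bc}| ≤ δ_{ab} δ_{ac}`; this is (4), and its square expands to (5), which is symmetric in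
the three points.

A realization gives the complete Pick property: the contraction hypothesis on `Y` is an equality of
Gram matrices, hence defines a contraction whose transfer function extends the multiplier.
Conversely, on two points `δ_H` is attained by a multiplier of norm one, so the Pick property forces
`δ_H = δ_G`. If `δ_H(x, y) = δ_G(x, y)`, the adjoints of multipliers vanishing at `y` and nearly
extremal at `x` send the component of `k_x` orthogonal to `k_y` to a multiple of `k_x` with almost
no loss of norm, and comparing inner products with the corresponding component of `k_z` gives the
inequality.

The Möbius involution of the ball at `Φ a` moves a realization to one with `Φ a = 0` without
changing `r_{bc}`; two realizations of one rescaling class then have the same Gram matrix, so they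
differ by a unitary map.
-/

noncomputable section

namespace FinRKHS

open scoped TensorProduct

section Contractions

variable {𝕜 E F G ι : Type*} [RCLike 𝕜]
  [NormedAddCommGroup E] [InnerProductSpace 𝕜 E] [NormedAddCommGroup F] [InnerProductSpace 𝕜 F]
  [NormedAddCommGroup G] [InnerProductSpace 𝕜 G]

theorem exists_contraction_of_norm_le {A : Type*} [AddCommGroup A] [Module 𝕜 A] (u : A →ₗ[𝕜] E)
    (g : A →ₗ[𝕜] F) [(LinearMap.range u).HasOrthogonalProjection] (h : ∀ x, ‖g x‖ ≤ ‖u x‖) :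
    ∃ V : E →L[𝕜] F, ‖V‖ ≤ 1 ∧ ∀ x, V (u x) = g x := by
  obtain ⟨r, hr⟩ := LinearMap.exists_rightInverse_of_surjective u.rangeRestrict
    (LinearMap.range_eq_top.mpr u.surjective_rangeRestrict)
  have hur (y : LinearMap.range u) : u (r y) = y := congrArg Subtype.val (LinearMap.congr_fun hr y)
  let w : LinearMap.range u →L[𝕜] F := (g ∘ₗ r).mkContinuous 1 fun y => by
    simpa [hur] using h (r y)
  refine ⟨w ∘L (LinearMap.range u).orthogonalProjectionOnto, ?_, fun x => ?_⟩
  · exact (ContinuousLinearMap.opNorm_comp_le _ _).trans <| mul_le_one₀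
      (LinearMap.mkContinuous_norm_le _ zero_le_one _) (norm_nonneg _)
      (Submodule.orthogonalProjectionOnto_norm_le _)
  · have hproj : (LinearMap.range u).orthogonalProjectionOnto (u x) = ⟨u x, x, rfl⟩ :=
      Submodule.orthogonalProjectionOnto_mem_subspace_eq_self (⟨u x, x, rfl⟩ : LinearMap.range u)
    have hg : g (r ⟨u x, x, rfl⟩ - x) = 0 := norm_le_zero_iff.mp <| by
      simpa [hur] using h (r ⟨u x, x, rfl⟩ - x)
    rw [ContinuousLinearMap.comp_apply, hproj]
    simpa [w, sub_eq_zero] using hg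

theorem inner_linearCombination (f : ι → E) (a b : ι →₀ 𝕜) :
    inner 𝕜 (Finsupp.linearCombination 𝕜 f a) (Finsupp.linearCombination 𝕜 f b) =
      a.sum fun i x => b.sum fun j y => conj x * (y * inner 𝕜 (f i) (f j)) := by
  simp only [Finsupp.linearCombination_apply, Finsupp.sum, sum_inner, inner_smul_left]
  simp only [inner_sum, inner_smul_right, Finset.mul_sum]

theorem norm_linearCombination_le_of_inner_eq_add {f : ι → E} {g : ι → F} {d : ι → G}
    (h : ∀ i j, inner 𝕜 (f i) (f j) = inner 𝕜 (g i) (g j) + inner 𝕜 (d i) (d j))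
    (a : ι →₀ 𝕜) :
    ‖Finsupp.linearCombination 𝕜 g a‖ ≤ ‖Finsupp.linearCombination 𝕜 f a‖ := by
  have hinner : inner 𝕜 (Finsupp.linearCombination 𝕜 f a) (Finsupp.linearCombination 𝕜 f a) =
      inner 𝕜 (Finsupp.linearCombination 𝕜 g a) (Finsupp.linearCombination 𝕜 g a) +
        inner 𝕜 (Finsupp.linearCombination 𝕜 d a) (Finsupp.linearCombination 𝕜 d a) := by
    simp only [inner_linearCombination, h, mul_add, Finsupp.sum_add]
  simp only [inner_self_eq_norm_sq_to_K] at hinner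
  norm_cast at hinner
  exact le_of_sq_le_sq (by rw [hinner]; exact le_add_of_nonneg_right (sq_nonneg _)) (norm_nonneg _)

theorem exists_contraction_of_inner_eq_add [FiniteDimensional 𝕜 E] {f : ι → E} {g : ι → F}
    {d : ι → G} (h : ∀ i j, inner 𝕜 (f i) (f j) = inner 𝕜 (g i) (g j) + inner 𝕜 (d i) (d j)) :
    ∃ V : E →L[𝕜] F, ‖V‖ ≤ 1 ∧ ∀ i, V (f i) = g i := by
  obtain ⟨V, hV, hVf⟩ := exists_contraction_of_norm_le (Finsupp.linearCombination 𝕜 f)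
    (Finsupp.linearCombination 𝕜 g) (norm_linearCombination_le_of_inner_eq_add h)
  exact ⟨V, hV, fun i => by simpa using hVf (Finsupp.single i 1)⟩

theorem exists_linearIsometryEquiv_of_inner_eq [FiniteDimensional 𝕜 E] {f g : ι → E}
    (h : ∀ i j, inner 𝕜 (f i) (f j) = inner 𝕜 (g i) (g j)) :
    ∃ U : E ≃ₗᵢ[𝕜] E, ∀ i, U (f i) = g i := by
  have hfg (i j) : inner 𝕜 (f i) (f j) = inner 𝕜 (g i) (g j) + inner 𝕜 (0 : E) 0 := by
    rw [h, inner_zero_left, add_zero]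
  have hgf (i j) : inner 𝕜 (g i) (g j) = inner 𝕜 (f i) (f j) + inner 𝕜 (0 : E) 0 := by
    rw [h, inner_zero_left, add_zero]
  obtain ⟨V, -, hVf⟩ := exists_contraction_of_inner_eq_add hfg
  have hnorm (y : Submodule.span 𝕜 (Set.range f)) : ‖V y‖ = ‖y‖ := by
    obtain ⟨a, ha⟩ := Finsupp.mem_span_range_iff_exists_finsupp.mp y.2
    have hVy : V y = Finsupp.linearCombination 𝕜 g a := by
      rw [← ha, Finsupp.linearCombination_apply, map_finsuppSum]
      simp only [map_smul, hVf]
    rw [hVy, Submodule.coe_norm, ← ha]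
    exact le_antisymm (norm_linearCombination_le_of_inner_eq_add hfg a)
      (norm_linearCombination_le_of_inner_eq_add hgf a)
  let L : Submodule.span 𝕜 (Set.range f) →ₗᵢ[𝕜] E := ⟨V.toLinearMap.domRestrict _, hnorm⟩
  refine ⟨L.extend.toLinearIsometryEquiv rfl, fun i => ?_⟩
  exact (L.extend_apply ⟨f i, Submodule.subset_span ⟨i, rfl⟩⟩).trans (hVf i)

end Contractions

section Defect

variable {E F : Type*} [NormedAddCommGroup E] [InnerProductSpace ℂ E] [CompleteSpace E]
  [NormedAddCommGroup F] [InnerProductSpace ℂ F] [CompleteSpace F]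

theorem one_sub_adjoint_comp_self_nonneg (V : E →L[ℂ] F) (hV : ‖V‖ ≤ 1) :
    0 ≤ (1 - V.adjoint ∘L V : E →L[ℂ] E) := by
  rw [ContinuousLinearMap.nonneg_iff_isPositive, ContinuousLinearMap.isPositive_iff_complex]
  intro x
  have hinner : inner ℂ ((1 - V.adjoint ∘L V : E →L[ℂ] E) x) x
      = ((‖x‖ ^ 2 - ‖V x‖ ^ 2 : ℝ) : ℂ) := by
    simp [ContinuousLinearMap.adjoint_inner_left, inner_self_eq_norm_sq_to_K]
  have hle : ‖V x‖ ≤ ‖x‖ := by simpa using V.le_of_opNorm_le hV x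
  rw [hinner]
  exact ⟨rfl, sub_nonneg.mpr (pow_le_pow_left₀ (norm_nonneg _) hle 2)⟩

theorem exists_defect (V : E →L[ℂ] F) (hV : ‖V‖ ≤ 1) :
    ∃ D : E →L[ℂ] E, ∀ x y, inner ℂ (D x) (D y) = inner ℂ x y - inner ℂ (V x) (V y) := by
  obtain ⟨D, hD⟩ :=
    CStarAlgebra.nonneg_iff_eq_star_mul_self.mp (one_sub_adjoint_comp_self_nonneg V hV)
  refine ⟨D, fun x y => ?_⟩
  calc inner ℂ (D x) (D y) = inner ℂ x ((star D * D) y) := by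
        rw [ContinuousLinearMap.star_eq_adjoint, mul_apply_eq_comp,
          ContinuousLinearMap.adjoint_inner_right]
    _ = inner ℂ x y - inner ℂ (V x) (V y) := by
        simp [← hD, ContinuousLinearMap.adjoint_inner_right]

theorem norm_sq_inner_sub_inner_le (V : E →L[ℂ] F) (hV : ‖V‖ ≤ 1) (u v : E) :
    ‖inner ℂ u v - inner ℂ (V u) (V v)‖ ^ 2 ≤
      (‖u‖ ^ 2 - ‖V u‖ ^ 2) * (‖v‖ ^ 2 - ‖V v‖ ^ 2) := by
  obtain ⟨D, hD⟩ := exists_defect V hV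
  have hnorm (w : E) : ‖D w‖ ^ 2 = ‖w‖ ^ 2 - ‖V w‖ ^ 2 := by
    have := hD w w
    simp only [inner_self_eq_norm_sq_to_K] at this
    exact_mod_cast this
  rw [← hD, ← hnorm, ← hnorm, ← mul_pow]
  exact pow_le_pow_left₀ (norm_nonneg _) (norm_inner_le_norm _ _) 2

end Defect

section TransferFunction

variable {E P Q K : Type*} [NormedAddCommGroup E] [InnerProductSpace ℂ E]
  [NormedAddCommGroup P] [InnerProductSpace ℂ P] [NormedAddCommGroup Q] [InnerProductSpace ℂ Q]
  [NormedAddCommGroup K] [InnerProductSpace ℂ K] [FiniteDimensional ℂ K]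

theorem exists_transfer_function (V : WithLp 2 (P × (E ⊗[ℂ] K)) →L[ℂ] WithLp 2 (Q × K))
    (hV : ‖V‖ ≤ 1) {z : E} (hz : ‖z‖ < 1) :
    ∃ (S : P →ₗ[ℂ] Q) (D : P →ₗ[ℂ] K), ∀ v q d,
      V (WithLp.toLp 2 (v, z ⊗ₜ[ℂ] d)) = WithLp.toLp 2 (q, d) ↔ q = S v ∧ d = D v := by
  let inState : K →ₗ[ℂ] WithLp 2 (P × (E ⊗[ℂ] K)) :=
    (WithLp.linearEquiv 2 ℂ _).symm.toLinearMap ∘ₗ LinearMap.inr ℂ _ _ ∘ₗ TensorProduct.mk ℂ E K z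
  let inSignal : P →ₗ[ℂ] WithLp 2 (P × (E ⊗[ℂ] K)) :=
    (WithLp.linearEquiv 2 ℂ _).symm.toLinearMap ∘ₗ LinearMap.inl ℂ _ _
  let outState : WithLp 2 (P × (E ⊗[ℂ] K)) →ₗ[ℂ] K :=
    (WithLp.sndL 2 ℂ Q K).toLinearMap ∘ₗ V.toLinearMap
  let outSignal : WithLp 2 (P × (E ⊗[ℂ] K)) →ₗ[ℂ] Q :=
    (WithLp.fstL 2 ℂ Q K).toLinearMap ∘ₗ V.toLinearMap
  have hsplit (v d) : WithLp.toLp 2 (v, z ⊗ₜ[ℂ] d) = inSignal v + inState d := by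
    apply WithLp.ofLp_injective
    ext <;> simp [inSignal, inState]
  have hcontr (d : K) : ‖outState (inState d)‖ ≤ ‖z‖ * ‖d‖ := calc
    ‖outState (inState d)‖ ≤ ‖V (inState d)‖ := WithLp.norm_snd_le _ _
    _ ≤ ‖inState d‖ := by simpa using V.le_of_opNorm_le hV (inState d)
    _ = ‖z‖ * ‖d‖ := by simp [inState]
  have hinj : Function.Injective (LinearMap.id - outState ∘ₗ inState : K →ₗ[ℂ] K) := by
    rw [injective_iff_map_eq_zero]
    intro d hd
    have hfix : d = outState (inState d) := sub_eq_zero.mp hd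
    by_contra hne
    have := hcontr d
    rw [← hfix] at this
    exact (mul_lt_of_lt_one_left (norm_pos_iff.mpr hne) hz).not_ge this
  let Ψ : K ≃ₗ[ℂ] K := LinearEquiv.ofInjectiveEndo _ hinj
  let D : P →ₗ[ℂ] K := Ψ.symm.toLinearMap ∘ₗ outState ∘ₗ inSignal
  refine ⟨outSignal ∘ₗ (inSignal + inState ∘ₗ D), D, fun v q d => ?_⟩
  have hstate : outState (inSignal v + inState d) = d ↔ d = D v := by
    rw [map_add, ← eq_sub_iff_add_eq, eq_comm]
    exact (LinearEquiv.eq_symm_apply Ψ).symm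
  rw [hsplit, ← (WithLp.ofLp_injective 2).eq_iff, Prod.ext_iff]
  change outSignal _ = q ∧ outState _ = d ↔ _
  rw [hstate]
  constructor <;> rintro ⟨rfl, rfl⟩ <;> exact ⟨rfl, rfl⟩

theorem exists_schur_extension [FiniteDimensional ℂ E] [FiniteDimensional ℂ P] [CompleteSpace Q]
    {X : Type*} {ζ : X → E} (hζ : ∀ b, ‖ζ b‖ < 1) {Y : Set X} (S : Y → P →ₗ[ℂ] Q) (D : Y → P → K)
    (h : ∀ (b b' : Y) (v v' : P), inner ℂ v v' - inner ℂ (S b v) (S b' v') =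
      (1 - inner ℂ (ζ b) (ζ b')) * inner ℂ (D b v) (D b' v')) :
    ∃ (S' : X → P →ₗ[ℂ] Q) (D' : X → P → K) (B : X → P → WithLp 2 (P × (E ⊗[ℂ] K))),
      (∀ b : Y, S' b = S b) ∧ ∀ b b' v v', inner ℂ v v' - inner ℂ (S' b v) (S' b' v') =
        (1 - inner ℂ (ζ b) (ζ b')) * inner ℂ (D' b v) (D' b' v') +
          inner ℂ (B b v) (B b' v') := by
  have : CompleteSpace (WithLp 2 (P × (E ⊗[ℂ] K))) := FiniteDimensional.complete ℂ _
  have : CompleteSpace K := FiniteDimensional.complete ℂ _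
  obtain ⟨V, hV, hVY⟩ := exists_contraction_of_inner_eq_add (𝕜 := ℂ)
    (f := fun i : Y × P => WithLp.toLp 2 (i.2, ζ i.1 ⊗ₜ[ℂ] D i.1 i.2))
    (g := fun i => WithLp.toLp 2 (S i.1 i.2, D i.1 i.2)) (d := fun _ => (0 : K))
    fun i j => by
      simp only [WithLp.prod_inner_apply, TensorProduct.inner_tmul, inner_zero_left]
      linear_combination h i.1 j.1 i.2 j.2
  choose S' D' hSD using fun b => exists_transfer_function V hV (hζ b)
  obtain ⟨B, hB⟩ := exists_defect V hV
  refine ⟨S', fun b => D' b, fun b v => B (WithLp.toLp 2 (v, ζ b ⊗ₜ[ℂ] D' b v)), fun b => ?_,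
    fun b b' v v' => ?_⟩
  · ext v
    exact ((hSD b v _ _).mp (hVY (b, v))).1.symm
  · rw [hB, (hSD b v _ _).mpr ⟨rfl, rfl⟩, (hSD b' v' _ _).mpr ⟨rfl, rfl⟩]
    simp only [WithLp.prod_inner_apply, TensorProduct.inner_tmul]
    ring

end TransferFunction

section Multipliers

open Matrix

/-- The elementary tensor `z ⊗ h`, in the space of tuples from `E` by which `IsMatrixMultiplier`
realizes the tensor product. -/
def tens {E ι : Type*} [AddCommGroup E] [Module ℂ E] (z : EuclideanSpace ℂ ι) (h : E) :
    PiLp 2 (fun _ : ι => E) :=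
  WithLp.toLp 2 fun i => z i • h

theorem inner_tens {E ι : Type*} [NormedAddCommGroup E] [InnerProductSpace ℂ E] [Fintype ι]
    (z z' : EuclideanSpace ℂ ι) (h h' : E) :
    inner ℂ (tens z h) (tens z' h') = inner ℂ h h' * inner ℂ z z' := by
  simp only [tens, PiLp.inner_apply, inner_smul_left, inner_smul_right, Finset.mul_sum,
    RCLike.inner_apply]
  exact Finset.sum_congr rfl fun i _ => by ring

theorem finiteDimensional_of_finite {X : Type*} [Finite X] (H : Type*) [NormedAddCommGroup H]
    [InnerProductSpace ℂ H] [RKHS ℂ H X ℂ] : FiniteDimensional ℂ H :=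
  Module.Finite.of_injective (RKHS.coeCLM ℂ (H := H) (X := X) (V := ℂ)).toLinearMap
    RKHS.coeCLM_injective

variable {X : Type*} (H : Type*) [NormedAddCommGroup H] [InnerProductSpace ℂ H]
  [CompleteSpace H] [RKHS ℂ H X ℂ]

theorem k_self (x : X) : k H x x = (‖kvec H x‖ : ℂ) ^ 2 := inner_self_eq_norm_sq_to_K _

theorem kvec_kerSpan (Y : Set X) [Finite Y] (y : Y) :
    (kvec (kerSpan H Y) y : H) = kvec H (y : X) := by
  have : kvec (kerSpan H Y) y = ⟨kvec H y, Submodule.subset_span ⟨y, y.2, rfl⟩⟩ :=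
    ext_inner_right ℂ fun f => by
      rw [inner_kvec, kerSpan_apply, ← inner_kvec]
      rfl
  rw [this]

theorem k_kerSpan (Y : Set X) [Finite Y] (y z : Y) : k (kerSpan H Y) y z = k H (y : X) z := by
  rw [k, k, Submodule.coe_inner, kvec_kerSpan, kvec_kerSpan]

variable {p q : ℕ}

theorem inner_tens_kvec (v : EuclideanSpace ℂ (Fin p)) (x : X) (g : PiLp 2 (fun _ : Fin p => H)) :
    inner ℂ (tens v (kvec H x)) g = ∑ i, conj (v i) * (g i : H) x := by
  simp only [tens, PiLp.inner_apply, inner_smul_left, inner_kvec]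

theorem inner_tens_conjTranspose (m : Matrix (Fin p) (Fin q) ℂ) (x : X)
    (v : EuclideanSpace ℂ (Fin p)) (h : PiLp 2 (fun _ : Fin q => H)) :
    inner ℂ (tens (mᴴ.toEuclideanLin v) (kvec H x)) h =
      ∑ i, conj (v i) * ∑ j, m i j * (h j : H) x := by
  rw [inner_tens_kvec]
  simp only [toLpLin_apply, mulVec, dotProduct, map_sum, map_mul, conjTranspose_apply,
    RCLike.star_def, Complex.conj_conj, Finset.sum_mul, Finset.mul_sum]
  rw [Finset.sum_comm]
  exact Finset.sum_congr rfl fun i _ => Finset.sum_congr rfl fun j _ => by ring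

theorem isMatrixMultiplier_iff (m : X → Matrix (Fin p) (Fin q) ℂ)
    (T : PiLp 2 (fun _ : Fin q => H) →L[ℂ] PiLp 2 (fun _ : Fin p => H)) :
    IsMatrixMultiplier H m T ↔ ∀ x v, T.adjoint (tens v (kvec H x)) =
      tens ((m x)ᴴ.toEuclideanLin v) (kvec H x) := by
  constructor
  · intro hT x v
    refine ext_inner_right ℂ fun h => ?_
    rw [ContinuousLinearMap.adjoint_inner_left, inner_tens_kvec, inner_tens_conjTranspose]
    exact Finset.sum_congr rfl fun i _ => by rw [hT]
  · intro hT h i x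
    have := congrArg (fun f => inner ℂ f h) (hT x (EuclideanSpace.single i 1))
    simp only [ContinuousLinearMap.adjoint_inner_left, inner_tens_kvec] at this
    simpa [Finset.sum_ite_eq', ite_mul] using this

variable {H}

theorem IsMatrixMultiplier.norm_le_of_restriction {Y : Set X} [Finite Y]
    {m : X → Matrix (Fin p) (Fin q) ℂ} {n : Y → Matrix (Fin p) (Fin q) ℂ}
    {M : PiLp 2 (fun _ : Fin q => H) →L[ℂ] PiLp 2 (fun _ : Fin p => H)}
    {N : PiLp 2 (fun _ : Fin q => kerSpan H Y) →L[ℂ] PiLp 2 (fun _ : Fin p => kerSpan H Y)}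
    (hM : IsMatrixMultiplier H m M) (hN : IsMatrixMultiplier (kerSpan H Y) n N)
    (hmn : ∀ y : Y, m y = n y) : ‖N‖ ≤ ‖M‖ := by
  refine N.opNorm_le_bound (norm_nonneg M) fun h => ?_
  let h' : PiLp 2 (fun _ : Fin q => H) := WithLp.toLp 2 fun j => (h j : H)
  have hnorm : ‖h'‖ = ‖h‖ := by simp [PiLp.norm_eq_of_L2, h']
  have hproj (i) : N h i = (kerSpan H Y).orthogonalProjectionOnto (M h' i) := by
    refine RKHS.ext fun y => ?_
    rw [hN, ← inner_kvec (kerSpan H Y) (Submodule.orthogonalProjectionOnto _ _),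
      Submodule.inner_orthogonalProjectionOnto_eq_of_mem_left, kvec_kerSpan, inner_kvec, hM]
    exact Finset.sum_congr rfl fun j _ => by rw [hmn, kerSpan_apply]
  calc ‖N h‖ ≤ ‖M h'‖ := by
        simp only [PiLp.norm_eq_of_L2, hproj]
        gcongr
        exact Submodule.norm_orthogonalProjectionOnto_apply_le _ _
    _ ≤ ‖M‖ * ‖h‖ := hnorm ▸ M.le_opNorm h'

theorem IsMatrixMultiplier.exists_defect {m : X → Matrix (Fin p) (Fin q) ℂ}
    {T : PiLp 2 (fun _ : Fin q => H) →L[ℂ] PiLp 2 (fun _ : Fin p => H)}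
    (hT : IsMatrixMultiplier H m T) (hT1 : ‖T‖ ≤ 1) :
    ∃ D : X → EuclideanSpace ℂ (Fin p) → PiLp 2 (fun _ : Fin p => H), ∀ b b' v v',
      inner ℂ (D b v) (D b' v') = k H b' b * (inner ℂ v v' -
        inner ℂ ((m b)ᴴ.toEuclideanLin v) ((m b')ᴴ.toEuclideanLin v')) := by
  obtain ⟨D, hD⟩ := FinRKHS.exists_defect T.adjoint
    ((LinearIsometryEquiv.norm_map ContinuousLinearMap.adjoint T).trans_le hT1)
  refine ⟨fun b v => D (tens v (kvec H b)), fun b b' v v' => ?_⟩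
  rw [hD, (isMatrixMultiplier_iff H m T).mp hT, (isMatrixMultiplier_iff H m T).mp hT, inner_tens,
    inner_tens, ← mul_sub, k]

variable {E : Type*} [NormedAddCommGroup E] [InnerProductSpace ℂ E]

theorem norm_lt_one_of_k_mul_one_sub_inner {ζ : X → E} {c : X → ℂ} (hc : ∀ b, c b ≠ 0)
    (h : ∀ b b', k H b' b * (1 - inner ℂ (ζ b) (ζ b')) = conj (c b) * c b') (b : X) :
    ‖ζ b‖ < 1 := by
  have hb : ‖kvec H b‖ ^ 2 * (1 - ‖ζ b‖ ^ 2) = ‖c b‖ ^ 2 := by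
    have := h b b
    rw [k_self, inner_self_eq_norm_sq_to_K, Complex.conj_mul',
      RCLike.ofReal_eq_complex_ofReal] at this
    exact_mod_cast this
  have hpos : 0 < ‖kvec H b‖ ^ 2 * (1 - ‖ζ b‖ ^ 2) := hb ▸ pow_pos (norm_pos_iff.mpr (hc b)) 2
  have := pos_of_mul_pos_right hpos (sq_nonneg _)
  exact (sq_lt_one_iff₀ (norm_nonneg _)).mp (sub_pos.mp this)

theorem exists_isMatrixMultiplier_of_k_mul_one_sub_inner [Finite X]
    [FiniteDimensional ℂ E] {ζ : X → E} {c : X → ℂ} (hc : ∀ b, c b ≠ 0)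
    (h : ∀ b b', k H b' b * (1 - inner ℂ (ζ b) (ζ b')) = conj (c b) * c b')
    (Y : Set X) (n : Y → Matrix (Fin p) (Fin q) ℂ)
    (N : PiLp 2 (fun _ : Fin q => kerSpan H Y) →L[ℂ] PiLp 2 (fun _ : Fin p => kerSpan H Y))
    (hN : IsMatrixMultiplier (kerSpan H Y) n N) (hN1 : ‖N‖ ≤ 1) :
    ∃ (m : X → Matrix (Fin p) (Fin q) ℂ)
      (M : PiLp 2 (fun _ : Fin q => H) →L[ℂ] PiLp 2 (fun _ : Fin p => H)),
      IsMatrixMultiplier H m M ∧ ‖M‖ ≤ 1 ∧ ∀ y : Y, m y = n y := by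
  have := finiteDimensional_of_finite (X := X) H
  obtain ⟨D₀, hD₀⟩ := hN.exists_defect hN1
  obtain ⟨S, D, B, hS, hSD⟩ := exists_schur_extension
    (norm_lt_one_of_k_mul_one_sub_inner hc h) (fun y => (n y)ᴴ.toEuclideanLin)
    (fun y v => (c y)⁻¹ • D₀ y v) fun b b' v v' => by
      rw [inner_smul_left, inner_smul_right, hD₀, k_kerSpan, map_inv₀]
      have hcb : conj (c b) ≠ 0 := by simpa using hc b
      have hcb' := hc b'
      field_simp
      linear_combination (-(inner ℂ v v' - inner ℂ ((n b)ᴴ.toEuclideanLin v)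
        ((n b')ᴴ.toEuclideanLin v'))) * h b b'
  obtain ⟨T, hT, hTS⟩ := exists_contraction_of_inner_eq_add (𝕜 := ℂ)
    (f := fun i : X × EuclideanSpace ℂ (Fin p) => tens i.2 (kvec H i.1))
    (g := fun i => tens (S i.1 i.2) (kvec H i.1))
    (d := fun i => WithLp.toLp 2 (c i.1 • D i.1 i.2, kvec H i.1 ⊗ₜ[ℂ] B i.1 i.2))
    fun ⟨b, v⟩ ⟨b', v'⟩ => by
      rw [WithLp.prod_inner_apply]
      simp only [TensorProduct.inner_tmul, inner_tens, inner_smul_left, inner_smul_right]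
      have := h b b'
      rw [k] at this
      linear_combination inner ℂ (kvec H b) (kvec H b') * hSD b b' v v' +
        inner ℂ (D b v) (D b' v') * this
  refine ⟨fun b => (toEuclideanLin.symm (S b))ᴴ, T.adjoint, ?_, ?_, fun y => ?_⟩
  · rw [isMatrixMultiplier_iff]
    intro x v
    simpa using hTS (x, v)
  · exact (LinearIsometryEquiv.norm_map ContinuousLinearMap.adjoint T).trans_le hT
  · simp [hS]

theorem hasCompletePick_of_k_mul_one_sub_inner [Finite X] [FiniteDimensional ℂ E] {ζ : X → E}
    {c : X → ℂ} (hc : ∀ b, c b ≠ 0)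
    (h : ∀ b b', k H b' b * (1 - inner ℂ (ζ b) (ζ b')) = conj (c b) * c b') :
    HasCompletePick H := by
  intro p q Y n N hN hN1
  obtain ⟨m, M, hM, hM1, hmn⟩ :=
    exists_isMatrixMultiplier_of_k_mul_one_sub_inner hc h Y n N hN hN1.le
  exact ⟨m, M, hM, le_antisymm hM1 (hN1 ▸ hM.norm_le_of_restriction hN hmn), hmn⟩

variable (H) in
/-- `H` as the space of `1`-tuples from `H`. -/
def equivTupleOne : H ≃ₗᵢ[ℂ] PiLp 2 (fun _ : Fin 1 => H) where
  toLinearEquiv := (LinearEquiv.funUnique (Fin 1) ℂ H).symm ≪≫ₗ (WithLp.linearEquiv 2 ℂ _).symm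
  norm_map' h := by simp [PiLp.norm_eq_of_L2]

theorem hasPick_of_hasCompletePick [Finite X] (h : HasCompletePick H) : HasPick H := by
  intro Y n N hN hN1
  let e := equivTupleOne (kerSpan H Y)
  let e' := equivTupleOne H
  obtain ⟨m, M, hM, hM1, hmn⟩ := h 1 1 Y (fun y => Matrix.of fun _ _ => n y)
    ((e : _ →L[ℂ] _) ∘L N ∘L (e.symm : _ →L[ℂ] _))
    (fun h i x => by rw [Fin.sum_univ_one]; exact hN (h 0) x)
    (by
      rw [← hN1]
      exact e.toLinearIsometry.norm_toContinuousLinearMap_comp.trans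
        (ContinuousLinearMap.opNorm_comp_linearIsometryEquiv N e.symm))
  refine ⟨fun x => m x 0 0, (e'.symm : _ →L[ℂ] _) ∘L M ∘L (e' : _ →L[ℂ] _), fun h x => ?_, ?_,
    fun y => congrFun (congrFun (hmn y) 0) 0⟩
  · exact (hM (e' h) 0 x).trans (Fin.sum_univ_one _)
  · rw [← hM1]
    exact e'.symm.toLinearIsometry.norm_toContinuousLinearMap_comp.trans
      (ContinuousLinearMap.opNorm_comp_linearIsometryEquiv M e')

end Multipliers

section KernelRatio

variable {X : Type*} (H : Type*) [NormedAddCommGroup H] [InnerProductSpace ℂ H]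
  [CompleteSpace H] [RKHS ℂ H X ℂ]

theorem conj_k (x y : X) : conj (k H x y) = k H y x := inner_conj_symm _ _

theorem k_mul_k (x y : X) : k H x y * k H y x = (‖k H x y‖ : ℂ) ^ 2 := by
  rw [← conj_k H x y, Complex.mul_conj']

theorem norm_kHat (x y : X) : ‖kHat H x y‖ = ‖k H x y‖ / (‖kvec H x‖ * ‖kvec H y‖) := by
  simp only [kHat, kvecHat, inner_smul_left, inner_smul_right, norm_mul, k, RCLike.norm_conj,
    norm_inv, Complex.norm_real, norm_norm]
  field_simp

theorem norm_kHat_comm (x y : X) : ‖kHat H x y‖ = ‖kHat H y x‖ := by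
  rw [norm_kHat, norm_kHat, ← conj_k, RCLike.norm_conj, mul_comm]

theorem norm_kHat_le_one (x y : X) : ‖kHat H x y‖ ≤ 1 := by
  rw [norm_kHat]
  refine div_le_one_of_le₀ ?_ (by positivity)
  rw [k, mul_comm]
  exact norm_inner_le_norm _ _

theorem deltaH_nonneg (x y : X) : 0 ≤ deltaH H x y := Real.sqrt_nonneg _

theorem deltaH_sq (x y : X) : deltaH H x y ^ 2 = 1 - ‖kHat H x y‖ ^ 2 :=
  Real.sq_sqrt (sub_nonneg.mpr (pow_le_one₀ (norm_nonneg _) (norm_kHat_le_one H x y)))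

theorem deltaH_comm (x y : X) : deltaH H x y = deltaH H y x := by
  rw [deltaH, deltaH, norm_kHat_comm]

variable {H}

theorem deltaH_pos_of_linearIndependent {x y : X}
    (hxy : LinearIndependent ℂ ![kvec H x, kvec H y]) : 0 < deltaH H x y := by
  have hx : kvec H x ≠ 0 := hxy.ne_zero 0
  have hy : kvec H y ≠ 0 := hxy.ne_zero 1
  rw [deltaH, Real.sqrt_pos, sub_pos, sq_lt_one_iff₀ (norm_nonneg _)]
  refine lt_of_le_of_ne (norm_kHat_le_one H x y) fun h => ?_
  rw [norm_kHat_comm, norm_kHat, div_eq_one_iff_eq (by positivity), mul_comm] at h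
  obtain ⟨r, -, hr⟩ := (norm_inner_eq_norm_iff hx hy).mp h
  exact (LinearIndependent.pair_iff' hx).mp hxy r hr.symm

variable (H)

/-- The number `k_{ba} k_{ac} / (k_{bc} k_{aa})`. It does not change under rescaling, and `1 /
kerRatio H a b c` is the `(b, c)` entry of the kernel of the rescaling for which `k_a = 1`. -/
def kerRatio (a b c : X) : ℂ := (k H b a * k H a c) / (k H b c * k H a a)

theorem conj_kerRatio (a b c : X) : conj (kerRatio H a b c) = kerRatio H a c b := by
  simp only [kerRatio, map_div₀, map_mul, conj_k]
  ring

theorem kerRatio_self (a b : X) : kerRatio H a b b = 1 - deltaH H a b ^ 2 := by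
  have hsq : deltaH H a b ^ 2 = 1 - ‖k H b a‖ ^ 2 / (‖kvec H b‖ ^ 2 * ‖kvec H a‖ ^ 2) := by
    rw [deltaH_sq, norm_kHat_comm, norm_kHat, div_pow, mul_pow]
  rw [kerRatio, k_mul_k, k_self, k_self, ← Complex.ofReal_pow (deltaH H a b), hsq]
  push_cast
  ring

theorem angular_rotate (a b c : X) : angular H a b c = angular H b c a := by
  rw [angular, angular]
  ring_nf

/-- Positivity of the Gram matrix `(1 - kerRatio H a i j)`, `i, j ∈ {b, c}`: the form which the
Pick condition takes for three points. -/
def PickCondition (a b c : X) : Prop := ‖1 - kerRatio H a b c‖ ≤ deltaH H a b * deltaH H a c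

variable {H}

theorem PickCondition.swap {a b c : X} (h : PickCondition H a b c) : PickCondition H a c b := by
  rwa [PickCondition, ← conj_kerRatio, ← map_one conj, ← map_sub, RCLike.norm_conj, mul_comm]

theorem LFsq_le_iff {a b c : X} (hab : 0 < deltaH H a b) :
    LFsq H a b c ≤ deltaH H a c ^ 2 ↔ PickCondition H a b c := by
  change 1 / deltaH H a b ^ 2 * ‖1 - kerRatio H a b c‖ ^ 2 ≤ _ ↔ _
  rw [one_div, inv_mul_le_iff₀ (by positivity), ← mul_pow, PickCondition,
    pow_le_pow_iff_left₀ (norm_nonneg _) (by have := deltaH_nonneg H a c; positivity) two_ne_zero]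

variable (hk : ∀ a b : X, k H a b ≠ 0)
include hk

theorem norm_kvec_pos (x : X) : 0 < ‖kvec H x‖ :=
  norm_pos_iff.mpr (inner_self_ne_zero.mp (hk x x))

theorem norm_kHat_pos (x y : X) : 0 < ‖kHat H x y‖ := by
  rw [norm_kHat]
  exact div_pos (norm_pos_iff.mpr (hk x y)) (mul_pos (norm_kvec_pos hk x) (norm_kvec_pos hk y))

theorem norm_kerRatio (a b c : X) :
    ‖kerRatio H a b c‖ = ‖kHat H a b‖ * ‖kHat H a c‖ / ‖kHat H b c‖ := by
  have hb := (norm_kvec_pos hk b).ne'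
  have hc := (norm_kvec_pos hk c).ne'
  rw [norm_kHat_comm H a b]
  simp only [kerRatio, norm_kHat, k_self, norm_div, norm_mul, norm_pow, Complex.norm_real,
    norm_norm]
  field_simp

theorem angular_eq_arg_kerRatio (a b c : X) : angular H a b c = (kerRatio H a c b).arg := by
  have hpos : 0 < (‖k H b c‖ ^ 2 * ‖kvec H a‖ ^ 2)⁻¹ := by
    have := norm_kvec_pos hk a
    have := norm_pos_iff.mpr (hk b c)
    positivity
  have hratio : kerRatio H a c b = ((‖k H b c‖ ^ 2 * ‖kvec H a‖ ^ 2)⁻¹ : ℝ) *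
      (k H a b * k H b c * k H c a) := by
    have := hk b c
    have := hk c b
    push_cast
    rw [← k_mul_k, ← k_self, kerRatio]
    field_simp
  rw [hratio, Complex.arg_real_mul _ hpos, angular]

theorem re_kerRatio (a b c : X) : (kerRatio H a b c).re =
    ‖kHat H a b‖ * ‖kHat H a c‖ / ‖kHat H b c‖ * Real.cos (angular H a b c) := by
  rw [angular_eq_arg_kerRatio hk, ← norm_kerRatio hk, ← conj_kerRatio H a b c,
    ← RCLike.norm_conj, Complex.norm_mul_cos_arg, Complex.conj_re]

theorem pickCondition_iff_cos (a b c : X) :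
    PickCondition H a b c ↔
      1 / ‖kHat H a b‖ ^ 2 + 1 / ‖kHat H b c‖ ^ 2 + 1 / ‖kHat H a c‖ ^ 2 - 1 ≤
        2 * Real.cos (angular H a b c) / (‖kHat H a b‖ * ‖kHat H b c‖ * ‖kHat H a c‖) := by
  have hp := norm_kHat_pos hk a b
  have hq := norm_kHat_pos hk b c
  have hr := norm_kHat_pos hk a c
  have hnorm : ‖1 - kerRatio H a b c‖ ^ 2 =
      1 - 2 * (kerRatio H a b c).re + ‖kerRatio H a b c‖ ^ 2 := by
    simp only [← Complex.normSq_eq_norm_sq, Complex.normSq_sub, map_one, one_mul, Complex.conj_re]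
    ring
  rw [re_kerRatio hk, norm_kerRatio hk] at hnorm
  rw [PickCondition, ← pow_le_pow_iff_left₀ (norm_nonneg _)
    (mul_nonneg (deltaH_nonneg H a b) (deltaH_nonneg H a c)) two_ne_zero, mul_pow, deltaH_sq,
    deltaH_sq, hnorm, ← sub_nonneg, iff_comm, ← sub_nonneg]
  set p := ‖kHat H a b‖
  set q := ‖kHat H b c‖
  set r := ‖kHat H a c‖
  rw [← mul_nonneg_iff_of_pos_left (show 0 < p ^ 2 * r ^ 2 by positivity)]
  refine iff_of_eq (congrArg _ ?_)
  field_simp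
  ring

theorem PickCondition.rotate {a b c : X} (h : PickCondition H a b c) : PickCondition H b c a := by
  rw [pickCondition_iff_cos hk] at h ⊢
  rw [← angular_rotate, norm_kHat_comm H c a, norm_kHat_comm H b a]
  convert h using 1 <;> ring

theorem PickCondition.of_pair {x : Fin 3 → X} {i j : Fin 3} (hij : i ≠ j)
    (h : ∀ l, PickCondition H (x i) (x j) (x l)) : PickCondition H (x 0) (x 1) (x 2) := by
  fin_cases i <;> fin_cases j
  · exact (hij rfl).elim
  · exact h 2
  · exact (h 1).swap
  · exact ((h 2).swap.rotate hk).rotate hk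
  · exact (hij rfl).elim
  · exact ((h 0).rotate hk).rotate hk
  · exact (h 1).rotate hk
  · exact (h 0).swap.rotate hk
  · exact (hij rfl).elim

end KernelRatio

section Gleason

variable {X : Type*} (H : Type*) [NormedAddCommGroup H] [InnerProductSpace ℂ H]
  [CompleteSpace H] [RKHS ℂ H X ℂ]

/-- The component of `k_x` orthogonal to `k_y`. -/
def residual (x y : X) : H := kvec H x - (k H x y / k H y y) • kvec H y

theorem inner_kvec_residual_self (x y : X) : inner ℂ (kvec H y) (residual H x y) = 0 := by
  rw [residual, inner_sub_right, inner_smul_right]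
  change k H x y - k H x y / k H y y * k H y y = 0
  rw [div_mul_cancel_of_imp, sub_self]
  intro h
  rw [k, inner_self_eq_zero.mp h, inner_zero_left]

theorem inner_residual (x y z : X) :
    inner ℂ (residual H z y) (residual H x y) = k H x z - k H x y * k H y z / k H y y := by
  rw [residual, inner_sub_left, inner_smul_left, inner_kvec_residual_self, mul_zero, sub_zero,
    residual, inner_sub_right, inner_smul_right, div_mul_eq_mul_div]
  rfl

variable {H}

theorem inner_residual_eq_kerRatio {x z : X} (hxz : k H x z ≠ 0) (y : X) :
    inner ℂ (residual H z y) (residual H x y) = k H x z * (1 - kerRatio H y x z) := by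
  rw [inner_residual, kerRatio]
  field_simp

theorem norm_residual {x : X} (hx : kvec H x ≠ 0) (y : X) :
    ‖residual H x y‖ = ‖kvec H x‖ * deltaH H x y := by
  have h := inner_residual_eq_kerRatio (inner_self_ne_zero.mpr hx) y
  rw [kerRatio_self, sub_sub_cancel, k_self, inner_self_eq_norm_sq_to_K, deltaH_comm,
    RCLike.ofReal_eq_complex_ofReal, ← mul_pow] at h
  exact (pow_left_inj₀ (norm_nonneg _) (mul_nonneg (norm_nonneg _) (deltaH_nonneg _ _ _))
    two_ne_zero).mp (by exact_mod_cast h)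

theorem IsMultiplier.adjoint_kvec {m : X → ℂ} {T : H →L[ℂ] H} (hT : IsMultiplier H m T) (x : X) :
    T.adjoint (kvec H x) = conj (m x) • kvec H x := by
  refine ext_inner_right ℂ fun h => ?_
  rw [ContinuousLinearMap.adjoint_inner_left, inner_kvec, hT, inner_smul_left, inner_kvec,
    Complex.conj_conj]

theorem IsMultiplier.adjoint_residual {m : X → ℂ} {T : H →L[ℂ] H} (hT : IsMultiplier H m T)
    {y : X} (hy : m y = 0) (x : X) : T.adjoint (residual H x y) = conj (m x) • kvec H x := by
  rw [residual, map_sub, map_smul, hT.adjoint_kvec, hT.adjoint_kvec, hy, map_zero, zero_smul,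
    smul_zero, sub_zero]

theorem norm_adjoint_le_one {T : H →L[ℂ] H} (hT : ‖T‖ ≤ 1) : ‖T.adjoint‖ ≤ 1 :=
  (LinearIsometryEquiv.norm_map ContinuousLinearMap.adjoint T).trans_le hT

theorem IsMultiplier.norm_le_deltaH {m : X → ℂ} {T : H →L[ℂ] H} (hT : IsMultiplier H m T)
    (hT1 : ‖T‖ ≤ 1) {x y : X} (hx : kvec H x ≠ 0) (hy : m y = 0) : ‖m x‖ ≤ deltaH H x y := by
  have h := T.adjoint.le_of_opNorm_le (norm_adjoint_le_one hT1) (residual H x y)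
  rw [hT.adjoint_residual hy, norm_smul, RCLike.norm_conj, one_mul, norm_residual hx,
    mul_comm] at h
  exact le_of_mul_le_mul_left h (norm_pos_iff.mpr hx)

theorem isLUB_deltaG {x : X} (hx : kvec H x ≠ 0) (y : X) :
    IsLUB {r : ℝ | ∃ (m : X → ℂ) (T : H →L[ℂ] H),
      IsMultiplier H m T ∧ m y = 0 ∧ ‖T‖ ≤ 1 ∧ r = (m x).re} (deltaG H x y) := by
  refine isLUB_csSup ⟨0, 0, 0, fun h z => ?_, rfl, by simp, rfl⟩ ⟨deltaH H x y, ?_⟩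
  · simp [RKHS.coe_zero]
  · rintro r ⟨m, T, hT, hm, hT1, rfl⟩
    exact (Complex.re_le_norm _).trans (hT.norm_le_deltaH hT1 hx hm)

theorem deltaG_le_deltaH {x : X} (hx : kvec H x ≠ 0) (y : X) : deltaG H x y ≤ deltaH H x y := by
  refine (isLUB_deltaG hx y).2 ?_
  rintro r ⟨m, T, hT, hm, hT1, rfl⟩
  exact (Complex.re_le_norm _).trans (hT.norm_le_deltaH hT1 hx hm)

-- The operator is `h ↦ (δ ‖k_x‖²)⁻¹ ⟨k_x, h⟩ r`, where `r` is the residual of `k_x`.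
theorem exists_extremal_operator {x y : X} (hx : kvec H x ≠ 0) (hδ : 0 < deltaH H x y) :
    ∃ N : H →L[ℂ] H, ‖N‖ = 1 ∧ ∀ h : H, (N h) x = deltaH H x y * h x ∧ (N h) y = 0 := by
  have hn : 0 < ‖kvec H x‖ := norm_pos_iff.mpr hx
  have hr : inner ℂ (kvec H x) (residual H x y) = (‖kvec H x‖ ^ 2 * deltaH H x y ^ 2 : ℂ) := by
    rw [residual, inner_sub_right, inner_smul_right]
    change k H x x - k H x y / k H y y * k H y x = _
    rw [div_mul_eq_mul_div, ← inner_residual, inner_self_eq_norm_sq_to_K, norm_residual hx,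
      RCLike.ofReal_eq_complex_ofReal, Complex.ofReal_mul, mul_pow]
  refine ⟨(innerSL ℂ (kvec H x)).smulRight
    (((‖kvec H x‖ ^ 2 * deltaH H x y)⁻¹ : ℂ) • residual H x y), ?_, fun h => ⟨?_, ?_⟩⟩
  · have : ‖((‖kvec H x‖ ^ 2 * deltaH H x y)⁻¹ : ℂ)‖ = (‖kvec H x‖ ^ 2 * deltaH H x y)⁻¹ := by
      rw [norm_inv, norm_mul, norm_pow, Complex.norm_real, Complex.norm_real, norm_norm,
        Real.norm_of_nonneg hδ.le]
    rw [ContinuousLinearMap.norm_smulRight_apply, innerSL_apply_norm, norm_smul, this,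
      norm_residual hx]
    field_simp
  · have h1 : (‖kvec H x‖ : ℂ) ≠ 0 := by exact_mod_cast hn.ne'
    have h2 : (deltaH H x y : ℂ) ≠ 0 := by exact_mod_cast hδ.ne'
    rw [← inner_kvec, ContinuousLinearMap.smulRight_apply, innerSL_apply_apply, inner_smul_right,
      inner_smul_right, hr, inner_kvec]
    field_simp
  · rw [← inner_kvec, ContinuousLinearMap.smulRight_apply, inner_smul_right, inner_smul_right,
      inner_kvec_residual_self, mul_zero, mul_zero]

theorem deltaH_kerSpan (Y : Set X) [Finite Y] (x y : Y) :
    deltaH (kerSpan H Y) x y = deltaH H (x : X) y := by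
  have h : ∀ z : Y, ‖kvec (kerSpan H Y) z‖ = ‖kvec H (z : X)‖ := fun z => by
    rw [← kvec_kerSpan, Submodule.coe_norm]
  rw [deltaH, deltaH, norm_kHat, norm_kHat, k_kerSpan, h, h]

theorem HasPick.deltaH_eq_deltaG [Finite X] (h : HasPick H) {x y : X}
    (hxy : LinearIndependent ℂ ![kvec H x, kvec H y]) : deltaH H x y = deltaG H x y := by
  classical
  have hx : kvec H x ≠ 0 := hxy.ne_zero 0
  let Y : Set X := {x, y}
  let x' : Y := ⟨x, Or.inl rfl⟩
  let y' : Y := ⟨y, Or.inr rfl⟩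
  have hne : y' ≠ x' := fun h => by
    have hyx : y = x := congrArg Subtype.val h
    exact absurd (hxy.injective (a₁ := 0) (a₂ := 1) (by simp [hyx])) (by decide)
  obtain ⟨N, hN, hNxy⟩ := exists_extremal_operator (x := x') (y := y')
    (fun h0 => hx (by rw [← kvec_kerSpan H Y x', h0]; rfl))
    (by rw [deltaH_kerSpan]; exact deltaH_pos_of_linearIndependent hxy)
  rw [deltaH_kerSpan] at hNxy
  let n : Y → ℂ := fun z => if z = x' then (deltaH H x y : ℂ) else 0
  have hNmul : IsMultiplier (kerSpan H Y) n N := by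
    rintro g ⟨z, hz⟩
    obtain rfl | rfl : z = x ∨ z = y := hz
    · exact (hNxy g).1.trans (congrArg (· * _) (if_pos rfl).symm)
    · exact (hNxy g).2.trans (mul_eq_zero_of_left (if_neg hne) _).symm
  obtain ⟨m, M, hM, hM1, hm⟩ := h Y n N hNmul hN
  have hmx : m x = deltaH H x y := (hm x').trans (if_pos rfl)
  have hmy : m y = 0 := (hm y').trans (if_neg hne)
  exact le_antisymm ((isLUB_deltaG hx y).1 ⟨m, M, hM, hmy, hM1.le, by rw [hmx, Complex.ofReal_re]⟩)
    (deltaG_le_deltaH hx y)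

-- As `re (m x)` tends to `δ_H(x, y)`, the contraction `T*` becomes isometric on the residual of
-- `k_x`, so it preserves inner products with that residual and the last term disappears.
theorem IsMultiplier.norm_inner_residual_le {m : X → ℂ} {T : H →L[ℂ] H}
    (hT : IsMultiplier H m T) (hT1 : ‖T‖ ≤ 1) {x y z : X} (hx : kvec H x ≠ 0) (hz : kvec H z ≠ 0)
    (hy : m y = 0) :
    ‖inner ℂ (residual H z y) (residual H x y)‖ ≤ deltaH H z y * deltaH H x y * ‖k H x z‖ +
      ‖residual H z y‖ * (‖kvec H x‖ * √(deltaH H x y ^ 2 - (m x).re ^ 2)) := by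
  set u := residual H z y
  set v := residual H x y
  set V := T.adjoint
  have hVu : V u = conj (m z) • kvec H z := hT.adjoint_residual hy z
  have hVv : V v = conj (m x) • kvec H x := hT.adjoint_residual hy x
  have himage : ‖inner ℂ (V u) (V v)‖ ≤ deltaH H z y * deltaH H x y * ‖k H x z‖ := by
    rw [hVu, hVv, inner_smul_left, inner_smul_right, norm_mul, norm_mul, Complex.conj_conj,
      RCLike.norm_conj, ← mul_assoc]
    change ‖m z‖ * ‖m x‖ * ‖k H x z‖ ≤ _
    gcongr
    · exact deltaH_nonneg H z y
    · exact hT.norm_le_deltaH hT1 hz hy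
    · exact hT.norm_le_deltaH hT1 hx hy
  have hdefect : ‖v‖ ^ 2 - ‖V v‖ ^ 2 ≤ ‖kvec H x‖ ^ 2 * (deltaH H x y ^ 2 - (m x).re ^ 2) := by
    rw [hVv, norm_smul, RCLike.norm_conj, norm_residual hx, ← sq_abs (m x).re]
    have := pow_le_pow_left₀ (abs_nonneg _) (Complex.abs_re_le_norm (m x)) 2
    nlinarith [mul_le_mul_of_nonneg_left this (sq_nonneg ‖kvec H x‖)]
  have hdiff : ‖inner ℂ u v - inner ℂ (V u) (V v)‖ ≤
      ‖u‖ * (‖kvec H x‖ * √(deltaH H x y ^ 2 - (m x).re ^ 2)) := by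
    refine abs_le_of_sq_le_sq' ?_ (by positivity) |>.2
    have hre : (m x).re ^ 2 ≤ deltaH H x y ^ 2 := sq_le_sq'
      (neg_le_of_abs_le ((Complex.abs_re_le_norm _).trans (hT.norm_le_deltaH hT1 hx hy)))
      ((Complex.re_le_norm _).trans (hT.norm_le_deltaH hT1 hx hy))
    rw [mul_pow, mul_pow, Real.sq_sqrt (sub_nonneg.mpr hre)]
    refine (norm_sq_inner_sub_inner_le V (norm_adjoint_le_one hT1) u v).trans ?_
    refine mul_le_mul (sub_le_self _ (sq_nonneg _)) hdefect ?_ (sq_nonneg _)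
    have := V.le_of_opNorm_le (norm_adjoint_le_one hT1) v
    rw [one_mul] at this
    exact sub_nonneg.mpr (pow_le_pow_left₀ (norm_nonneg _) this 2)
  calc ‖inner ℂ u v‖ = ‖inner ℂ (V u) (V v) + (inner ℂ u v - inner ℂ (V u) (V v))‖ := by
        rw [add_sub_cancel]
    _ ≤ _ := (norm_add_le _ _).trans (add_le_add himage hdiff)

theorem pickCondition_of_deltaH_eq_deltaG {x y z : X} (hxz : k H x z ≠ 0)
    (h : deltaH H x y = deltaG H x y) : PickCondition H y x z := by
  have hx : kvec H x ≠ 0 := fun h0 => hxz (by rw [k, h0, inner_zero_right])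
  have hz : kvec H z ≠ 0 := fun h0 => hxz (by rw [k, h0, inner_zero_left])
  have hlim : ‖inner ℂ (residual H z y) (residual H x y)‖ ≤
      deltaH H z y * deltaH H x y * ‖k H x z‖ +
        ‖residual H z y‖ * (‖kvec H x‖ * √(deltaH H x y ^ 2 - deltaG H x y ^ 2)) := by
    have hlub := isLUB_deltaG hx y
    refine closure_minimal (t := {r : ℝ | ‖inner ℂ (residual H z y) (residual H x y)‖ ≤
      deltaH H z y * deltaH H x y * ‖k H x z‖ +
        ‖residual H z y‖ * (‖kvec H x‖ * √(deltaH H x y ^ 2 - r ^ 2))}) ?_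
      (isClosed_le continuous_const (by fun_prop)) (hlub.mem_closure hlub.nonempty)
    rintro r ⟨m, T, hT, hm, hT1, rfl⟩
    exact hT.norm_inner_residual_le hT1 hx hz hm
  rw [h, sub_self, Real.sqrt_zero, mul_zero, mul_zero, add_zero, ← h,
    inner_residual_eq_kerRatio hxz, norm_mul, mul_comm] at hlim
  rw [PickCondition, mul_comm, deltaH_comm H y, deltaH_comm H y]
  exact le_of_mul_le_mul_right hlim (norm_pos_iff.mpr hxz)

end Gleason

section Rescaling

variable {X X' : Type*} {H H' : Type*} [NormedAddCommGroup H] [InnerProductSpace ℂ H]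
  [CompleteSpace H] [RKHS ℂ H X ℂ] [NormedAddCommGroup H'] [InnerProductSpace ℂ H']
  [CompleteSpace H'] [RKHS ℂ H' X' ℂ]

theorem kerRatio_kerSpan (Y : Set X) [Finite Y] (a b c : Y) :
    kerRatio (kerSpan H Y) a b c = kerRatio H (a : X) b c := by
  simp only [kerRatio, k_kerSpan]

theorem IsRescaling.kerRatio_eq {e : X ≃ X'} (h : IsRescaling H H' e) (a b c : X) :
    kerRatio H a b c = kerRatio H' (e a) (e b) (e c) := by
  obtain ⟨γ, hγ, h⟩ := h
  have hfactor : γ b * conj (γ a) * (γ a * conj (γ c)) ≠ 0 := by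
    simp only [mul_ne_zero_iff, ne_eq, map_eq_zero, hγ, not_false_eq_true, and_self]
  rw [kerRatio, kerRatio, h, h, h, h, ← mul_div_mul_left _ _ hfactor]
  ring

variable (hk : ∀ a b, k H a b ≠ 0)
include hk

theorem kerRatio_base (a b : X) : kerRatio H a a b = 1 := by
  rw [kerRatio, mul_comm]
  exact div_self (mul_ne_zero (hk _ _) (hk _ _))

theorem kerRatio_change_base (a a' b c : X) : kerRatio H a' b c =
    kerRatio H a a' a' * kerRatio H a b c / (kerRatio H a b a' * kerRatio H a a' c) := by
  simp only [kerRatio]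
  have := hk a a
  have := hk a a'
  have := hk a' a
  have := hk b a
  have := hk a c
  field_simp [hk]

theorem isRescaling_iff_kerRatio_eq (hk' : ∀ a b, k H' a b ≠ 0) (e : X ≃ X') (a : X) :
    IsRescaling H H' e ↔ ∀ b c, kerRatio H a b c = kerRatio H' (e a) (e b) (e c) := by
  refine ⟨fun h => h.kerRatio_eq a, fun h => ?_⟩
  have ha : (‖kvec H a‖ : ℂ) ≠ 0 := by exact_mod_cast (norm_kvec_pos hk a).ne'
  have ha' : (‖kvec H' (e a)‖ : ℂ) ≠ 0 := by exact_mod_cast (norm_kvec_pos hk' (e a)).ne'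
  refine ⟨fun b => k H' (e b) (e a) / k H b a * (‖kvec H a‖ / ‖kvec H' (e a)‖),
    fun b => mul_ne_zero (div_ne_zero (hk' _ _) (hk _ _)) (div_ne_zero ha ha'), fun b c => ?_⟩
  have hbc := h b c
  rw [kerRatio, kerRatio, div_eq_div_iff (mul_ne_zero (hk _ _) (hk _ _))
    (mul_ne_zero (hk' _ _) (hk' _ _)), k_self, k_self] at hbc
  simp only [map_mul, map_div₀, conj_k, Complex.conj_ofReal]
  have := hk b a
  have := hk a c
  field_simp
  linear_combination hbc

end Rescaling

section Model

variable {X : Type*} {H : Type*} [NormedAddCommGroup H] [InnerProductSpace ℂ H]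
  [CompleteSpace H] [RKHS ℂ H X ℂ]

variable (H) in
/-- The vectors `ζ b` realize the rescaling of `H` for which `k_a = 1` as a space with the
Drury-Arveson kernel `1 / (1 - ⟨ζ b, ζ c⟩)`. -/
def IsModelAt {E : Type*} [NormedAddCommGroup E] [InnerProductSpace ℂ E] (a : X) (ζ : X → E) :
    Prop :=
  ∀ b c, inner ℂ (ζ b) (ζ c) = 1 - kerRatio H a b c

theorem IsModelAt.norm_eq_deltaH {E : Type*} [NormedAddCommGroup E] [InnerProductSpace ℂ E]
    {a : X} {ζ : X → E} (h : IsModelAt H a ζ) (b : X) : ‖ζ b‖ = deltaH H a b := by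
  have hsq := h b b
  rw [kerRatio_self, sub_sub_cancel, inner_self_eq_norm_sq_to_K,
    RCLike.ofReal_eq_complex_ofReal] at hsq
  exact (pow_left_inj₀ (norm_nonneg _) (deltaH_nonneg _ _ _) two_ne_zero).mp (by exact_mod_cast hsq)

theorem deltaH_lt_one (hk : ∀ a b, k H a b ≠ 0) (a b : X) : deltaH H a b < 1 := by
  rw [← sq_lt_one_iff₀ (deltaH_nonneg _ _ _), deltaH_sq]
  exact sub_lt_self 1 (pow_pos (norm_kHat_pos hk a b) 2)

-- The complete Pick criterion uses `k_{b'b}` where a model has `k_{bb'}`, whence the conjugates.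
theorem IsModelAt.hasCompletePick [Finite X] {ι : Type*} [Fintype ι] {a : X}
    {ζ : X → EuclideanSpace ℂ ι} (hk : ∀ a b, k H a b ≠ 0) (h : IsModelAt H a ζ) :
    HasCompletePick H := by
  have ha : (‖kvec H a‖ : ℂ) ≠ 0 := by exact_mod_cast (norm_kvec_pos hk a).ne'
  let ξ : X → EuclideanSpace ℂ ι := fun b => WithLp.toLp 2 fun i => conj (ζ b i)
  have hξ : ∀ b b', inner ℂ (ξ b) (ξ b') = inner ℂ (ζ b') (ζ b) := fun b b' => by
    simp only [ξ, PiLp.inner_apply, RCLike.inner_apply, Complex.conj_conj]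
    exact Finset.sum_congr rfl fun i _ => mul_comm _ _
  refine hasCompletePick_of_k_mul_one_sub_inner (ζ := ξ) (c := fun b => k H b a / ‖kvec H a‖)
    (fun b => div_ne_zero (hk b a) ha) fun b b' => ?_
  have := hk b' b
  rw [hξ, h, sub_sub_cancel, kerRatio, map_div₀, conj_k, Complex.conj_ofReal, k_self]
  field_simp

theorem IsModelAt.injective {E : Type*} [NormedAddCommGroup E] [InnerProductSpace ℂ E] {a : X}
    {ζ : X → E} (hk : ∀ a b, k H a b ≠ 0) (hδ : Pairwise fun b c => 0 < deltaH H b c)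
    (h : IsModelAt H a ζ) : Function.Injective ζ := by
  intro b c hbc
  by_contra hne
  have hker : ∀ b c, kerRatio H a b c = 1 - inner ℂ (ζ b) (ζ c) := fun b c => by
    rw [h, sub_sub_cancel]
  have hne0 : kerRatio H a c c ≠ 0 :=
    div_ne_zero (mul_ne_zero (hk _ _) (hk _ _)) (mul_ne_zero (hk _ _) (hk _ _))
  have hone : kerRatio H b c c = 1 := by
    rw [kerRatio_change_base hk a, hker b b, hker c b, hker b c, hbc, ← hker]
    exact div_self (mul_ne_zero hne0 hne0)
  rw [kerRatio_self, sub_eq_self] at hone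
  exact (hδ hne).ne' (by exact_mod_cast pow_eq_zero_iff two_ne_zero |>.mp hone)

end Model

section Realization

variable {n : ℕ}

theorem k_DA_ne_zero (z w : Ball n) : k (DA n) z w ≠ 0 := by
  rw [kDA]
  refine inv_ne_zero fun h => ?_
  have hlt := norm_inner_ball_lt w z
  rw [← sub_eq_zero.mp h, norm_one] at hlt
  exact lt_irrefl _ hlt

theorem kerRatio_DA (a b c : Ball n) : kerRatio (DA n) a b c =
    (1 - inner ℂ (a : EuclideanSpace ℂ (Fin n)) (a : EuclideanSpace ℂ (Fin n))) *
      (1 - inner ℂ (b : EuclideanSpace ℂ (Fin n)) (c : EuclideanSpace ℂ (Fin n))) /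
      ((1 - inner ℂ (b : EuclideanSpace ℂ (Fin n)) (a : EuclideanSpace ℂ (Fin n))) *
        (1 - inner ℂ (a : EuclideanSpace ℂ (Fin n)) (c : EuclideanSpace ℂ (Fin n)))) := by
  simp only [kerRatio, kDA]
  field_simp

theorem isModelAt_DA {a : Ball n} (ha : (a : EuclideanSpace ℂ (Fin n)) = 0) :
    IsModelAt (DA n) a ((↑) : Ball n → EuclideanSpace ℂ (Fin n)) := fun b c => by
  simp only [kerRatio_DA, ha, inner_zero_left, inner_zero_right, sub_zero, one_mul, div_one,
    sub_sub_cancel]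

variable {X : Type*} [Finite X] {H : Type*} [NormedAddCommGroup H] [InnerProductSpace ℂ H]
  [CompleteSpace H] [RKHS ℂ H X ℂ] {Φ : X → Ball n}

theorem IsRealization.kerRatio_eq (h : IsRealization H Φ) (a b c : X) :
    kerRatio H a b c = kerRatio (DA n) (Φ a) (Φ b) (Φ c) := by
  obtain ⟨e, he, h⟩ := h
  rw [h.kerRatio_eq, kerRatio_kerSpan, he, he, he]

theorem isRealization_of_kerRatio_eq (hk : ∀ a b, k H a b ≠ 0) (hΦ : Function.Injective Φ) (a : X)
    (h : ∀ b c, kerRatio H a b c = kerRatio (DA n) (Φ a) (Φ b) (Φ c)) : IsRealization H Φ := by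
  refine ⟨Equiv.ofInjective Φ hΦ, fun b => rfl, (isRescaling_iff_kerRatio_eq hk ?_ _ a).mpr ?_⟩
  · intro b c
    rw [k_kerSpan]
    exact k_DA_ne_zero _ _
  · intro b c
    rw [h, kerRatio_kerSpan]
    rfl

theorem IsRealization.isModelAt (h : IsRealization H Φ) {a : X}
    (ha : (Φ a : EuclideanSpace ℂ (Fin n)) = 0) :
    IsModelAt H a fun b => (Φ b : EuclideanSpace ℂ (Fin n)) := fun b c => by
  rw [isModelAt_DA ha, h.kerRatio_eq]

theorem IsModelAt.isRealization {a : X} (hk : ∀ a b, k H a b ≠ 0)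
    (hδ : Pairwise fun b c => 0 < deltaH H b c)
    (h : IsModelAt H a fun b => (Φ b : EuclideanSpace ℂ (Fin n))) : IsRealization H Φ := by
  have ha : (Φ a : EuclideanSpace ℂ (Fin n)) = 0 := by
    rw [← inner_self_eq_zero (𝕜 := ℂ), h, kerRatio_base hk, sub_self]
  refine isRealization_of_kerRatio_eq hk (h.injective hk hδ).of_comp a fun b c => ?_
  rw [← sub_right_inj (a := (1 : ℂ)), ← isModelAt_DA ha, ← h]

end Realization

section NormalForm

theorem forall_fin_three_of_symm {P : Fin 3 → Fin 3 → Prop} (hsymm : ∀ i j, P i j → P j i)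
    (h0 : ∀ j, P 0 j) (h11 : P 1 1) (h12 : P 1 2) (h22 : P 2 2) (i j : Fin 3) : P i j := by
  fin_cases i
  · exact h0 j
  · fin_cases j
    exacts [hsymm _ _ (h0 1), h11, h12]
  · fin_cases j
    exacts [hsymm _ _ (h0 2), hsymm _ _ h12, h22]

theorem inner_pair (a b c d : ℂ) : inner ℂ !₂[a, b] !₂[c, d] = c * conj a + d * conj b := by
  simp only [PiLp.inner_apply, RCLike.inner_apply, Fin.sum_univ_two,
    Matrix.cons_val_zero, Matrix.cons_val_one]

variable {X : Type*} {H : Type*} [NormedAddCommGroup H] [InnerProductSpace ℂ H]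
  [CompleteSpace H] [RKHS ℂ H X ℂ]

theorem IsNormalTriple.coe_zero {x : Fin 3 ≃ X} {Φ : X → Ball 2} {s : ℝ} {w : ℂ} {t : ℝ}
    (h : IsNormalTriple x Φ s w t) : (Φ (x 0) : EuclideanSpace ℂ (Fin 2)) = 0 := by
  rw [h.2.2.1]
  ext i
  fin_cases i <;> rfl

theorem isModelAt_of_triple (hk : ∀ a b, k H a b ≠ 0) (x : Fin 3 ≃ X) {E : Type*}
    [NormedAddCommGroup E] [InnerProductSpace ℂ E] {v : Fin 3 → E} (h0 : v 0 = 0)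
    (h1 : ‖v 1‖ = deltaH H (x 0) (x 1)) (h2 : ‖v 2‖ = deltaH H (x 0) (x 2))
    (h12 : inner ℂ (v 1) (v 2) = 1 - kerRatio H (x 0) (x 1) (x 2)) :
    IsModelAt H (x 0) (v ∘ x.symm) := by
  have hself : ∀ i, ‖v i‖ = deltaH H (x 0) (x i) →
      inner ℂ (v i) (v i) = 1 - kerRatio H (x 0) (x i) (x i) := fun i hi => by
    rw [kerRatio_self, sub_sub_cancel, inner_self_eq_norm_sq_to_K, hi,
      RCLike.ofReal_eq_complex_ofReal]
  have hmodel : ∀ i j, inner ℂ (v i) (v j) = 1 - kerRatio H (x 0) (x i) (x j) := by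
    refine forall_fin_three_of_symm (fun i j h => ?_) (fun j => ?_) (hself 1 h1) h12 (hself 2 h2)
    · rw [← inner_conj_symm, h, map_sub, map_one, conj_kerRatio]
    · rw [h0, inner_zero_left, kerRatio_base hk, sub_self]
  intro b c
  simpa only [Function.comp_apply, Equiv.apply_symm_apply] using hmodel (x.symm b) (x.symm c)

theorem exists_normalTriple (hk : ∀ a b, k H a b ≠ 0) (x : Fin 3 ≃ X)
    (hs : 0 < deltaH H (x 0) (x 1)) (h : PickCondition H (x 0) (x 1) (x 2)) :
    ∃ (s : ℝ) (w : ℂ) (t : ℝ) (Φ : X → Ball 2), IsNormalTriple x Φ s w t ∧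
      IsModelAt H (x 0) fun b => (Φ b : EuclideanSpace ℂ (Fin 2)) := by
  set s := deltaH H (x 0) (x 1)
  set r := deltaH H (x 0) (x 2)
  set w : ℂ := (1 - kerRatio H (x 0) (x 1) (x 2)) / s
  have hw : ‖w‖ ≤ r := by
    rw [norm_div, Complex.norm_real, Real.norm_of_nonneg hs.le, div_le_iff₀' hs]
    exact h
  set t := √(r ^ 2 - ‖w‖ ^ 2)
  let v : Fin 3 → EuclideanSpace ℂ (Fin 2) := ![!₂[0, 0], !₂[(s : ℂ), 0], !₂[w, (t : ℂ)]]
  have hmodel : IsModelAt H (x 0) (v ∘ x.symm) := by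
    refine isModelAt_of_triple hk x ?_ ?_ ?_ ?_
    · ext i
      fin_cases i <;> rfl
    · change ‖!₂[(s : ℂ), 0]‖ = s
      simp [EuclideanSpace.norm_eq, Fin.sum_univ_two, Real.sqrt_sq hs.le]
    · change ‖!₂[w, (t : ℂ)]‖ = r
      have ht : t ^ 2 = r ^ 2 - ‖w‖ ^ 2 :=
        Real.sq_sqrt (sub_nonneg.mpr (pow_le_pow_left₀ (norm_nonneg w) hw 2))
      simp [EuclideanSpace.norm_eq, Fin.sum_univ_two, ht, r, Real.sqrt_sq (deltaH_nonneg _ _ _)]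
    · change inner ℂ !₂[(s : ℂ), 0] !₂[w, (t : ℂ)] = _
      have : (s : ℂ) ≠ 0 := by exact_mod_cast hs.ne'
      rw [inner_pair, Complex.conj_ofReal, map_zero, mul_zero, add_zero, div_mul_cancel₀ _ this]
  refine ⟨s, w, t, fun b => ⟨v (x.symm b), ?_⟩, ⟨hs, Real.sqrt_nonneg _, ?_, ?_, ?_⟩, hmodel⟩
  · rw [mem_ball_zero_iff]
    exact (hmodel.norm_eq_deltaH b).trans_lt (deltaH_lt_one hk _ _)
  all_goals simp [v]

theorem IsNormalTriple.eq_of_inner_eq {X' : Type*} {x : Fin 3 ≃ X} {x' : Fin 3 ≃ X'} {s s' : ℝ}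
    {w w' : ℂ} {t t' : ℝ} {Φ : X → Ball 2} {Φ' : X' → Ball 2} (h : IsNormalTriple x Φ s w t)
    (h' : IsNormalTriple x' Φ' s' w' t')
    (hinner : ∀ i j, inner ℂ (Φ (x i)).1 (Φ (x j)).1 = inner ℂ (Φ' (x' i)).1 (Φ' (x' j)).1)
    (i : Fin 3) : Φ (x i) = Φ' (x' i) := by
  obtain ⟨hs, ht, h0, h1, h2⟩ := h
  obtain ⟨hs', ht', h0', h1', h2'⟩ := h'
  have h11 := hinner 1 1
  have h12 := hinner 1 2
  have h22 := hinner 2 2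
  simp only [h1, h1', h2, h2', inner_pair, map_zero, mul_zero, add_zero, Complex.conj_ofReal]
    at h11 h12 h22
  obtain rfl : s = s' := (mul_self_inj hs.le hs'.le).mp (by exact_mod_cast h11)
  obtain rfl : w = w' := mul_right_cancel₀ (by exact_mod_cast hs.ne') h12
  obtain rfl : t = t' := (mul_self_inj ht ht').mp (by exact_mod_cast add_left_cancel h22)
  apply Subtype.ext
  fin_cases i
  exacts [h0.trans h0'.symm, h1.trans h1'.symm, h2.trans h2'.symm]

end NormalForm

section Invariants

variable {X X' : Type*} {H H' : Type*} [NormedAddCommGroup H] [InnerProductSpace ℂ H]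
  [CompleteSpace H] [RKHS ℂ H X ℂ] [NormedAddCommGroup H'] [InnerProductSpace ℂ H']
  [CompleteSpace H'] [RKHS ℂ H' X' ℂ]

theorem kerRatio_self_eq_iff (a b : X) (a' b' : X') :
    kerRatio H a b b = kerRatio H' a' b' b' ↔ deltaH H a b = deltaH H' a' b' := by
  rw [kerRatio_self, kerRatio_self, sub_right_inj,
    ← pow_left_inj₀ (deltaH_nonneg _ _ _) (deltaH_nonneg _ _ _) two_ne_zero]
  norm_cast

theorem norm_kHat_eq_of_deltaH_eq {a b : X} {a' b' : X'} (h : deltaH H a b = deltaH H' a' b') :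
    ‖kHat H a b‖ = ‖kHat H' a' b'‖ := by
  rw [← pow_left_inj₀ (norm_nonneg _) (norm_nonneg _) two_ne_zero, ← sub_right_inj (a := (1 : ℝ)),
    ← deltaH_sq, ← deltaH_sq, h]

theorem invariants_eq_iff_isRescaling (hk : ∀ a b, k H a b ≠ 0) (hk' : ∀ a b, k H' a b ≠ 0)
    (x : Fin 3 ≃ X) (x' : Fin 3 ≃ X') :
    invariants H x = invariants H' x' ↔ IsRescaling H H' (x.symm.trans x') := by
  rw [invariants, invariants, Prod.mk.injEq, Prod.mk.injEq, Prod.mk.injEq,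
    angular_eq_arg_kerRatio hk, angular_eq_arg_kerRatio hk']
  constructor
  · rintro ⟨h01, h02, h12, harg⟩
    have hratio : kerRatio H (x 0) (x 2) (x 1) = kerRatio H' (x' 0) (x' 2) (x' 1) := by
      refine Complex.ext_norm_arg ?_ harg
      rw [norm_kerRatio hk, norm_kerRatio hk', norm_kHat_comm _ (x 2) (x 1),
        norm_kHat_comm _ (x' 2) (x' 1), norm_kHat_eq_of_deltaH_eq h01,
        norm_kHat_eq_of_deltaH_eq h02, norm_kHat_eq_of_deltaH_eq h12]
    have hratios :
        ∀ i j, kerRatio H (x 0) (x i) (x j) = kerRatio H' (x' 0) (x' i) (x' j) := by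
      refine forall_fin_three_of_symm (fun i j h => ?_) (fun j => ?_) ?_ ?_ ?_
      · rw [← conj_kerRatio, h, conj_kerRatio]
      · rw [kerRatio_base hk, kerRatio_base hk']
      · exact (kerRatio_self_eq_iff ..).mpr h01
      · rw [← conj_kerRatio, hratio, conj_kerRatio]
      · exact (kerRatio_self_eq_iff ..).mpr h02
    refine (isRescaling_iff_kerRatio_eq hk hk' _ (x 0)).mpr fun b c => ?_
    simpa only [Equiv.trans_apply, Equiv.symm_apply_apply, Equiv.apply_symm_apply]
      using hratios (x.symm b) (x.symm c)
  · intro h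
    have hratios : ∀ i j l,
        kerRatio H (x i) (x j) (x l) = kerRatio H' (x' i) (x' j) (x' l) := fun i j l => by
      simpa only [Equiv.trans_apply, Equiv.symm_apply_apply] using h.kerRatio_eq (x i) (x j) (x l)
    simp only [hratios, ← kerRatio_self_eq_iff, and_self]

end Invariants

section Moebius

variable {E : Type*} [NormedAddCommGroup E] [InnerProductSpace ℂ E]

/-- The involutive automorphism of the unit ball that exchanges `a` and `0`. With
`s = √(1 - ‖a‖²)`, the usual coefficient `(1 - s) / ‖a‖²` is written `1 / (1 + s)`, which makes
sense also at `a = 0`. -/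
def moebius (a z : E) : E :=
  (1 - inner ℂ a z)⁻¹ •
    ((1 - inner ℂ a z / (1 + √(1 - ‖a‖ ^ 2))) • a - (√(1 - ‖a‖ ^ 2) : ℂ) • z)

theorem one_sub_inner_ne_zero {z w : E} (hz : ‖z‖ < 1) (hw : ‖w‖ < 1) : 1 - inner ℂ z w ≠ 0 :=
  sub_ne_zero.mpr fun h => by
    have hle := norm_inner_le_norm (𝕜 := ℂ) z w
    rw [← h, norm_one] at hle
    exact hle.not_gt (mul_lt_one_of_nonneg_of_lt_one_left (norm_nonneg z) hz hw.le)

theorem one_sub_inner_self (a : E) : 1 - inner ℂ a a = ((1 - ‖a‖ ^ 2 : ℝ) : ℂ) := by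
  rw [inner_self_eq_norm_sq_to_K]
  push_cast
  rfl

theorem one_sub_norm_sq_pos {E : Type*} [SeminormedAddCommGroup E] {a : E} (ha : ‖a‖ < 1) :
    0 < 1 - ‖a‖ ^ 2 :=
  sub_pos.mpr ((sq_lt_one_iff₀ (norm_nonneg a)).mpr ha)

theorem inner_self_eq_one_sub_sqrt_sq {a : E} (ha : ‖a‖ < 1) :
    inner ℂ a a = 1 - (√(1 - ‖a‖ ^ 2) : ℂ) ^ 2 := by
  rw [← Complex.ofReal_pow, Real.sq_sqrt (one_sub_norm_sq_pos ha).le, ← one_sub_inner_self,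
    sub_sub_cancel]

theorem one_add_sqrt_ne_zero (r : ℝ) : (1 + √r : ℂ) ≠ 0 := by
  have : 0 < 1 + √r := by positivity
  exact_mod_cast this.ne'

theorem one_sub_inner_moebius {a z w : E} (ha : ‖a‖ < 1) (hz : ‖z‖ < 1) (hw : ‖w‖ < 1) :
    1 - inner ℂ (moebius a z) (moebius a w) =
      (1 - inner ℂ a a) * (1 - inner ℂ z w) / ((1 - inner ℂ z a) * (1 - inner ℂ a w)) := by
  have hza := one_sub_inner_ne_zero hz ha
  have haw := one_sub_inner_ne_zero ha hw
  have hs := one_add_sqrt_ne_zero (1 - ‖a‖ ^ 2)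
  simp only [moebius, inner_smul_left, inner_smul_right, inner_sub_left, inner_sub_right, map_sub,
    map_add, map_inv₀, map_div₀, map_one, Complex.conj_ofReal, inner_conj_symm,
    inner_self_eq_one_sub_sqrt_sq ha]
  generalize (√(1 - ‖a‖ ^ 2) : ℂ) = s at *
  field_simp
  ring

theorem one_sub_inner_left_moebius {a z : E} (ha : ‖a‖ < 1) (hz : ‖z‖ < 1) :
    1 - inner ℂ a (moebius a z) = (1 - inner ℂ a a) / (1 - inner ℂ a z) := by
  have haz := one_sub_inner_ne_zero ha hz
  have hs := one_add_sqrt_ne_zero (1 - ‖a‖ ^ 2)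
  simp only [moebius, inner_smul_right, inner_sub_right, inner_self_eq_one_sub_sqrt_sq ha]
  generalize (√(1 - ‖a‖ ^ 2) : ℂ) = s at *
  field_simp
  ring

theorem moebius_moebius {a z : E} (ha : ‖a‖ < 1) (hz : ‖z‖ < 1) : moebius a (moebius a z) = z := by
  have haz := one_sub_inner_ne_zero ha hz
  have hs := one_add_sqrt_ne_zero (1 - ‖a‖ ^ 2)
  have hs0 : (√(1 - ‖a‖ ^ 2) : ℂ) ≠ 0 := by
    exact_mod_cast (Real.sqrt_pos.mpr (one_sub_norm_sq_pos ha)).ne'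
  have hinner : inner ℂ a (moebius a z) = 1 - (1 - inner ℂ a a) / (1 - inner ℂ a z) := by
    rw [← one_sub_inner_left_moebius ha hz, sub_sub_cancel]
  rw [moebius, hinner, inner_self_eq_one_sub_sqrt_sq ha, moebius]
  generalize (√(1 - ‖a‖ ^ 2) : ℂ) = s at *
  match_scalars <;> field_simp <;> ring

theorem norm_moebius_lt_one {a z : E} (ha : ‖a‖ < 1) (hz : ‖z‖ < 1) : ‖moebius a z‖ < 1 := by
  have hdenom : (1 - inner ℂ z a) * (1 - inner ℂ a z) = ((‖1 - inner ℂ a z‖ ^ 2 : ℝ) : ℂ) := by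
    rw [← inner_conj_symm z a, Complex.ofReal_pow, ← Complex.conj_mul', map_sub, map_one]
  have hnorm : 1 - ‖moebius a z‖ ^ 2 =
      (1 - ‖a‖ ^ 2) * (1 - ‖z‖ ^ 2) / ‖1 - inner ℂ a z‖ ^ 2 := by
    have h := one_sub_inner_moebius ha hz hz
    rw [hdenom, one_sub_inner_self, one_sub_inner_self, one_sub_inner_self] at h
    exact_mod_cast h
  rw [← sq_lt_one_iff₀ (norm_nonneg _), ← sub_pos, hnorm]
  exact div_pos (mul_pos (one_sub_norm_sq_pos ha) (one_sub_norm_sq_pos hz))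
    (pow_pos (norm_pos_iff.mpr (one_sub_inner_ne_zero ha hz)) 2)

theorem differentiableOn_moebius {a : E} (ha : ‖a‖ < 1) :
    DifferentiableOn ℂ (moebius a) (Metric.ball 0 1) := by
  have hinner : Differentiable ℂ fun z : E => inner ℂ a z := (innerSL ℂ a).differentiable
  refine DifferentiableOn.smul (DifferentiableOn.inv ?_ fun z hz => ?_) ?_
  · exact (hinner.const_sub 1).differentiableOn
  · exact one_sub_inner_ne_zero ha (mem_ball_zero_iff.mp hz)
  · simp only [div_eq_mul_inv]
    exact (((hinner.mul_const _).const_sub 1).smul_const a |>.sub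
      (differentiable_id.const_smul _)).differentiableOn

end Moebius

section Congruence

variable {n : ℕ}

theorem norm_coe_ball_lt_one (z : Ball n) : ‖(z : EuclideanSpace ℂ (Fin n))‖ < 1 :=
  mem_ball_zero_iff.mp z.2

theorem IsHolomorphic.comp {f g : Ball n → Ball n} (hf : IsHolomorphic f) (hg : IsHolomorphic g) :
    IsHolomorphic (f ∘ g) := by
  obtain ⟨F, hF, hFf⟩ := hf
  obtain ⟨G, hG, hGg⟩ := hg
  refine ⟨F ∘ G, hF.comp hG fun z hz => ?_, fun z => ?_⟩
  · rw [hGg ⟨z, hz⟩]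
    exact (g ⟨z, hz⟩).2
  · rw [Function.comp_apply, hGg, hFf, Function.comp_apply]

theorem BallCongruent.symm {ι : Type*} {p q : ι → Ball n} (h : BallCongruent p q) :
    BallCongruent q p := by
  obtain ⟨φ, hφ, hφ', hpq⟩ := h
  exact ⟨φ.symm, hφ', hφ, fun i => by rw [← hpq, Equiv.symm_apply_apply]⟩

theorem BallCongruent.trans {ι : Type*} {p q r : ι → Ball n} (h : BallCongruent p q)
    (h' : BallCongruent q r) : BallCongruent p r := by
  obtain ⟨φ, hφ, hφ', hpq⟩ := h
  obtain ⟨ψ, hψ, hψ', hqr⟩ := h'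
  exact ⟨φ.trans ψ, hψ.comp hφ, hφ'.comp hψ', fun i => by rw [Equiv.trans_apply, hpq, hqr]⟩

/-- The Möbius involution exchanging `a` and `0`, as a permutation of the ball of `ℂⁿ`. -/
def ballMoebius (a : Ball n) : Ball n ≃ Ball n :=
  Function.Involutive.toPerm
    (fun z => ⟨moebius a z, mem_ball_zero_iff.mpr
      (norm_moebius_lt_one (norm_coe_ball_lt_one a) (norm_coe_ball_lt_one z))⟩)
    fun z => Subtype.ext (moebius_moebius (norm_coe_ball_lt_one a) (norm_coe_ball_lt_one z))

theorem ballCongruent_ballMoebius {ι : Type*} (a : Ball n) (p : ι → Ball n) :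
    BallCongruent p fun i => ballMoebius a (p i) :=
  have h : IsHolomorphic (ballMoebius a) :=
    ⟨_, differentiableOn_moebius (norm_coe_ball_lt_one a), fun _ => rfl⟩
  ⟨ballMoebius a, h, h, fun _ => rfl⟩

theorem inner_ballMoebius (a b c : Ball n) :
    inner ℂ (ballMoebius a b : EuclideanSpace ℂ (Fin n)) (ballMoebius a c) =
      1 - kerRatio (DA n) a b c := by
  rw [kerRatio_DA, ← one_sub_inner_moebius (norm_coe_ball_lt_one a) (norm_coe_ball_lt_one b)
    (norm_coe_ball_lt_one c), sub_sub_cancel]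
  rfl

theorem ballCongruent_of_inner_eq {ι : Type*} [Finite ι] {p q : ι → Ball n}
    (h : ∀ i j, inner ℂ (p i : EuclideanSpace ℂ (Fin n)) (p j : EuclideanSpace ℂ (Fin n)) =
      inner ℂ (q i : EuclideanSpace ℂ (Fin n)) (q j : EuclideanSpace ℂ (Fin n))) :
    BallCongruent p q := by
  obtain ⟨U, hU⟩ := exists_linearIsometryEquiv_of_inner_eq h
  have hmem : ∀ (V : EuclideanSpace ℂ (Fin n) ≃ₗᵢ[ℂ] EuclideanSpace ℂ (Fin n)) (z : Ball n),
      V z ∈ Metric.ball (0 : EuclideanSpace ℂ (Fin n)) 1 := fun V z => by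
    rw [mem_ball_zero_iff, V.norm_map]
    exact norm_coe_ball_lt_one z
  let φ : Ball n ≃ Ball n :=
    { toFun := fun z => ⟨U z, hmem U z⟩
      invFun := fun z => ⟨U.symm z, hmem U.symm z⟩
      left_inv := fun z => Subtype.ext (U.symm_apply_apply z)
      right_inv := fun z => Subtype.ext (U.apply_symm_apply z) }
  exact ⟨φ, ⟨U, U.toContinuousLinearEquiv.differentiable.differentiableOn, fun _ => rfl⟩,
    ⟨U.symm, U.symm.toContinuousLinearEquiv.differentiable.differentiableOn, fun _ => rfl⟩,
    fun i => Subtype.ext (hU i)⟩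

theorem ballCongruent_of_kerRatio_eq {ι : Type*} [Finite ι] {p q : ι → Ball n} (a : ι)
    (h : ∀ i j, kerRatio (DA n) (p a) (p i) (p j) = kerRatio (DA n) (q a) (q i) (q j)) :
    BallCongruent p q :=
  (ballCongruent_ballMoebius (p a) p).trans <|
    (ballCongruent_of_inner_eq fun i j => by
      rw [inner_ballMoebius, inner_ballMoebius, h]).trans
    (ballCongruent_ballMoebius (q a) q).symm

end Congruence

section Uniqueness

variable {X X' : Type*} [Finite X] [Finite X'] {H H' : Type*} [NormedAddCommGroup H]
  [InnerProductSpace ℂ H] [CompleteSpace H] [RKHS ℂ H X ℂ] [NormedAddCommGroup H']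
  [InnerProductSpace ℂ H'] [CompleteSpace H'] [RKHS ℂ H' X' ℂ] {x : Fin 3 ≃ X} {x' : Fin 3 ≃ X'}

theorem IsRescaling.kerRatio_realization_eq {n : ℕ} {e : X ≃ X'} (h : IsRescaling H H' e)
    {Φ : X → Ball n} {Φ' : X' → Ball n} (hΦ : IsRealization H Φ) (hΦ' : IsRealization H' Φ')
    (a b c : X) : kerRatio (DA n) (Φ a) (Φ b) (Φ c) =
      kerRatio (DA n) (Φ' (e a)) (Φ' (e b)) (Φ' (e c)) := by
  rw [← hΦ.kerRatio_eq, ← hΦ'.kerRatio_eq, h.kerRatio_eq]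

theorem IsNormalTriple.eq_of_isRescaling {s s' : ℝ} {w w' : ℂ} {t t' : ℝ} {Φ : X → Ball 2}
    {Φ' : X' → Ball 2} (hn : IsNormalTriple x Φ s w t) (hΦ : IsRealization H Φ)
    (hn' : IsNormalTriple x' Φ' s' w' t') (hΦ' : IsRealization H' Φ')
    (h : IsRescaling H H' (x.symm.trans x')) (i : Fin 3) : Φ (x i) = Φ' (x' i) := by
  refine hn.eq_of_inner_eq hn' (fun i j => ?_) i
  have hratio := h.kerRatio_realization_eq hΦ hΦ' (x 0) (x i) (x j)
  simp only [Equiv.trans_apply, Equiv.symm_apply_apply] at hratio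
  rw [isModelAt_DA hn.coe_zero, isModelAt_DA hn'.coe_zero, hratio]

theorem IsRealization.ballCongruent {n : ℕ} {Φ : X → Ball n} {Φ' : X' → Ball n}
    (hΦ : IsRealization H Φ) (hΦ' : IsRealization H' Φ')
    (h : IsRescaling H H' (x.symm.trans x')) :
    BallCongruent (fun i => Φ (x i)) fun i => Φ' (x' i) :=
  ballCongruent_of_kerRatio_eq 0 fun i j => by
    simpa only [Equiv.trans_apply, Equiv.symm_apply_apply]
      using h.kerRatio_realization_eq hΦ hΦ' (x 0) (x i) (x j)

end Uniqueness

section Characterization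

variable {X : Type*} {H : Type*} [NormedAddCommGroup H] [InnerProductSpace ℂ H]
  [CompleteSpace H] [RKHS ℂ H X ℂ]

theorem PickCondition.of_deltaH_eq_deltaG (hk : ∀ a b, k H a b ≠ 0) {x : Fin 3 ≃ X} {i j : Fin 3}
    (hij : i ≠ j) (h : deltaH H (x i) (x j) = deltaG H (x i) (x j)) :
    PickCondition H (x 0) (x 1) (x 2) :=
  .of_pair hk hij.symm fun _ => pickCondition_of_deltaH_eq_deltaG (hk _ _) h

theorem IsIrreducible.pairwise_linearIndependent (h : IsIrreducible H) :
    Pairwise fun a b => LinearIndependent ℂ ![kvec H a, kvec H b] := by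
  intro a b hab
  have hpair := h.linearIndependent.comp ![a, b] (injective_pair_iff_ne.mpr hab)
  rwa [← FinVec.map_eq] at hpair

end Characterization

end FinRKHS

end

open FinRKHS in
theorem theorem5p3_general {X : Type*} [Finite X] (H : Type*) [NormedAddCommGroup H]
    [InnerProductSpace ℂ H] [CompleteSpace H] [RKHS ℂ H X ℂ]
    (hk : ∀ a b, k H a b ≠ 0)
    (hind : Pairwise fun a b => LinearIndependent ℂ ![kvec H a, kvec H b]) (x : Fin 3 ≃ X) :
    List.TFAE
      [HasCompletePick H,
       HasPick H,
       ∃ i j : Fin 3, i ≠ j ∧ deltaH H (x i) (x j) = deltaG H (x i) (x j),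
       LFsq H (x 0) (x 1) (x 2) ≤ deltaH H (x 0) (x 2) ^ 2,
       1 / ‖kHat H (x 0) (x 1)‖ ^ 2 + 1 / ‖kHat H (x 1) (x 2)‖ ^ 2
           + 1 / ‖kHat H (x 0) (x 2)‖ ^ 2 - 1
         ≤ 2 * Real.cos (angular H (x 0) (x 1) (x 2)) /
           (‖kHat H (x 0) (x 1)‖ * ‖kHat H (x 1) (x 2)‖
             * ‖kHat H (x 0) (x 2)‖),
       ∃ (s : ℝ) (w : ℂ) (t : ℝ) (Φ : X → Ball 2),
         IsNormalTriple x Φ s w t ∧ IsRealization H Φ] ∧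
    ∀ {X' : Type*} [Finite X'] (H' : Type*) [NormedAddCommGroup H'] [InnerProductSpace ℂ H']
      [CompleteSpace H'] [RKHS ℂ H' X' ℂ]
      (_ : ∀ a b, k H' a b ≠ 0) (x' : Fin 3 ≃ X'),
      (invariants H x = invariants H' x' ↔ IsRescaling H H' (x.symm.trans x')) ∧
      (invariants H x = invariants H' x' →
        (∀ (s s' : ℝ) (w w' : ℂ) (t t' : ℝ) (Φ : X → Ball 2) (Φ' : X' → Ball 2),
          IsNormalTriple x Φ s w t → IsRealization H Φ →
          IsNormalTriple x' Φ' s' w' t' → IsRealization H' Φ' →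
          ∀ i, Φ (x i) = Φ' (x' i)) ∧
        (∀ (n : ℕ) (Φ : X → Ball n) (Φ' : X' → Ball n),
          IsRealization H Φ → IsRealization H' Φ' →
          BallCongruent (fun i => Φ (x i)) (fun i => Φ' (x' i)))) := by
  have hδ : Pairwise fun a b => 0 < deltaH H a b := fun _ _ hab =>
    deltaH_pos_of_linearIndependent (hind hab)
  have hx01 : x 0 ≠ x 1 := x.injective.ne zero_ne_one
  refine ⟨?_, fun H' _ _ _ _ hk' x' => ?_⟩
  · rw [LFsq_le_iff (hδ hx01), ← pickCondition_iff_cos hk]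
    tfae_have 1 → 2 := hasPick_of_hasCompletePick
    tfae_have 2 → 3 := fun h => ⟨0, 1, zero_ne_one, h.deltaH_eq_deltaG (hind hx01)⟩
    tfae_have 3 → 4 := fun ⟨_, _, hij, h⟩ => .of_deltaH_eq_deltaG hk hij h
    tfae_have 4 ↔ 5 := Iff.rfl
    tfae_have 4 → 6 := fun h =>
      let ⟨s, w, t, Φ, hΦ, hmodel⟩ := exists_normalTriple hk x (hδ hx01) h
      ⟨s, w, t, Φ, hΦ, hmodel.isRealization hk hδ⟩
    tfae_have 6 → 1 := fun ⟨_, _, _, _, hΦ, h⟩ => (h.isModelAt hΦ.coe_zero).hasCompletePick hk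
    tfae_finish
  · rw [invariants_eq_iff_isRescaling hk hk']
    refine ⟨Iff.rfl, fun h => ⟨?_, fun _ _ _ hΦ hΦ' => hΦ.ballCongruent hΦ' h⟩⟩
    exact fun _ _ _ _ _ _ _ _ hn hΦ hn' hΦ' => hn.eq_of_isRescaling hΦ hn' hΦ' h

theorem theorem5p3 {X : Type*} [Finite X] (H : Type*) [NormedAddCommGroup H]
    [InnerProductSpace ℂ H] [CompleteSpace H] [RKHS ℂ H X ℂ]
    (hH : FinRKHS.IsIrreducible H) (hdim : Module.finrank ℂ H = 3) (x : Fin 3 ≃ X) :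
    List.TFAE
      [FinRKHS.HasCompletePick H,
       FinRKHS.HasPick H,
       ∃ i j : Fin 3, i ≠ j ∧ FinRKHS.deltaH H (x i) (x j) = FinRKHS.deltaG H (x i) (x j),
       FinRKHS.LFsq H (x 0) (x 1) (x 2) ≤ FinRKHS.deltaH H (x 0) (x 2) ^ 2,
       1 / ‖FinRKHS.kHat H (x 0) (x 1)‖ ^ 2 + 1 / ‖FinRKHS.kHat H (x 1) (x 2)‖ ^ 2
           + 1 / ‖FinRKHS.kHat H (x 0) (x 2)‖ ^ 2 - 1
         ≤ 2 * Real.cos (FinRKHS.angular H (x 0) (x 1) (x 2)) /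
           (‖FinRKHS.kHat H (x 0) (x 1)‖ * ‖FinRKHS.kHat H (x 1) (x 2)‖
             * ‖FinRKHS.kHat H (x 0) (x 2)‖),
       ∃ (s : ℝ) (w : ℂ) (t : ℝ) (Φ : X → FinRKHS.Ball 2),
         FinRKHS.IsNormalTriple x Φ s w t ∧ FinRKHS.IsRealization H Φ] ∧
    ∀ {X' : Type*} [Finite X'] (H' : Type*) [NormedAddCommGroup H'] [InnerProductSpace ℂ H']
      [CompleteSpace H'] [RKHS ℂ H' X' ℂ]
      (_ : FinRKHS.IsIrreducible H') (_ : Module.finrank ℂ H' = 3) (x' : Fin 3 ≃ X'),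
      (FinRKHS.invariants H x = FinRKHS.invariants H' x' ↔
        FinRKHS.IsRescaling H H' (x.symm.trans x')) ∧
      (FinRKHS.invariants H x = FinRKHS.invariants H' x' →
        (∀ (s s' : ℝ) (w w' : ℂ) (t t' : ℝ) (Φ : X → FinRKHS.Ball 2) (Φ' : X' → FinRKHS.Ball 2),
          FinRKHS.IsNormalTriple x Φ s w t → FinRKHS.IsRealization H Φ →
          FinRKHS.IsNormalTriple x' Φ' s' w' t' → FinRKHS.IsRealization H' Φ' →
          ∀ i, Φ (x i) = Φ' (x' i)) ∧
        (∀ (n : ℕ) (Φ : X → FinRKHS.Ball n) (Φ' : X' → FinRKHS.Ball n),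
          FinRKHS.IsRealization H Φ → FinRKHS.IsRealization H' Φ' →
          FinRKHS.BallCongruent (fun i => Φ (x i)) (fun i => Φ' (x' i)))) :=
  theorem5p3_general H hH.k_ne_zero hH.pairwise_linearIndependent x |>.imp_right
    fun h _ _ H' _ _ _ _ hH' _ => h H' hH'.k_ne_zero
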